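/- Let $\Phi$ be the affine root system of type $D_4^{(1)}$, with simple roots $\alpha_1,\dots,\alpha_5$, where $\alpha_5$ is the central node of the Dynkin diagram (write $i\sim j$ if $\alpha_i,\alpha_j$ are joined), let $\delta=\alpha_1+\alpha_2+\alpha_3+\alpha_4+2\alpha_5$, and let $W=\langle\sigma_1,\dots,\sigma_5\rangle$ be its Weyl group. For $a=\sum_i a_i\alpha_i$ with $a_i\in\mathbb Z$ put $\mathbf x^a=\prod_i x_i^{a_i}$ and $v_i(a)=\sum_{j\sim i}a_j$. The Chinta–Gunnells action is the right action of $W$ on $\mathbb C(\mathbf x,u)$ with $$f|\sigma_i(\mathbf x;u)=f(\sigma_i\mathbf x;u)\,J(x_i,0)+f(\varepsilon_i\sigma_i\mathbf x;u)\,J(x_i,1),\qquad J(x,\epsilon)=\frac x2\Big(\frac{u-x}{1-ux}-(-1)^\epsilon\Big),$$ where $(\sigma_i\mathbf x)_j$ is $1/x_i$ if $j=i$, $x_ix_j$ if $j\sim i$, and $x_j$ otherwise, and $(\varepsilon_i\mathbf x)_j$ is $-x_j$ if $j\sim i$ and $x_j$ otherwise. For a monomial $g=\mathbf x^a$ put $Z_{W,g}=\sum_{w\in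 W}g|w$ and $Z_W=Z_{W,1}$. (1) There is a family of Laurent polynomials $C_a\in\mathbb Z[u][x,x^{-1}]$, $a\in\mathbb Z^5$, such that, for $g=\mathbf x^a$ and all $x_1,\dots,x_5\in\mathbb C^\times$, $u\in\mathbb C$ with $|\mathbf x^\delta|<1$ and $u\mathbf x^\beta\neq\pm1$ for all positive real roots $\beta$, every $g|w$ is regular at $(\mathbf x;u)$, the series $Z_{W,g}(\mathbf x;u)$ converges absolutely, and $$Z_{W,g}(\mathbf x;u)=C_a(\mathbf x^\delta)\,Z_W(\mathbf x;u).$$ (2) The family is the unique solution of the following recursion: $C_{n\delta}=x^n$ for $n\in\mathbb Z$; and for every $a$ and every $i$ with $v=v_i(a)<2a_i$, - if $v$ is odd, $C_a=0$ when $2a_i=v+1$, and otherwise $C_a=-C_{\sigma_i a+\alpha_i}$; - if $v$ is even, $C_a=u\,C_{a-\alpha_i}$ when $2a_i=v+2$, and otherwise $C_a=u\,C_{\sigma_i a+\alpha_i}+u\,C_{a-\alpha_i}-C_{\sigma_i a+2\alpha_i}$. This is a descent: attach to $a$ the $8$-tuple of the numbers $\pm(a_1-a_2)$, $\pm(a_5-a_1-a_2)$,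 $\pm(a_3+a_4-a_5)$, $\pm(a_3-a_4)$ in decreasing order, and compare monomials by the lexicographic order of these tuples. This order is well-founded, every index on the right-hand sides above is strictly smaller than $a$, and for every $a\notin\mathbb Z\delta$ there is an $i$ with $v_i(a)<2a_i$. (3) The analogue fails for finite Weyl groups: for every simply laced Dynkin diagram with at least one node and with finite Weyl group $W$, with the action and the averages defined by the same formulas, there is a monomial $g$ such that $Z_{W,g}$ is not of the form $c(u)\,Z_W$ with $c\in\mathbb C(u)$. -/

import Mathlib

open scoped AddMonoidAlgebra Polynomial LaurentPolynomial

noncomputable section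

namespace ChintaGunnells

variable {I : Type*} [Fintype I] [DecidableEq I] (Γ : SimpleGraph I) [DecidableRel Γ.Adj]

/-! ### Two identities in a field -/

theorem J_even {K : Type*} [Field K] (h2 : (2 : K) ≠ 0) (u y d : K) (hd : d = 1 - u * y)
    (h : d ≠ 0) : y / 2 * ((u - y) / d - (-1) ^ 0) = y * (u - 1) * (1 + y) / (2 * d) := by
  field_simp
  rw [hd]
  ring

theorem J_odd {K : Type*} [Field K] (h2 : (2 : K) ≠ 0) (u y d : K) (hd : d = 1 - u * y)
    (h : d ≠ 0) : y / 2 * ((u - y) / d - (-1) ^ 1) = y * (u + 1) * (1 - y) / (2 * d) := by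
  field_simp
  rw [hd]
  ring

theorem square_aux {K : Type*} [Field K] (h2 : (2 : K) ≠ 0) (u x f g : K) (hx : x ≠ 0)
    (h : 1 - u * x ≠ 0) (h' : x - u ≠ 0) (J : K → ℕ → K)
    (hJ : ∀ y e, J y e = y / 2 * ((u - y) / (1 - u * y) - (-1) ^ e)) :
    f * J x⁻¹ 0 * J x 0 + g * J x⁻¹ 0 * J x 1 +
      (g * J x⁻¹ 1 * J x 0 + f * J x⁻¹ 1 * J x 1) = f := by
  have e : 1 - u * x⁻¹ = (x - u) / x := by field_simp
  have h'' : 1 - u * x⁻¹ ≠ 0 := by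
    rw [e]
    exact div_ne_zero h' hx
  rw [hJ, hJ, hJ, hJ, J_even h2 u x _ rfl h, J_odd h2 u x _ rfl h, J_even h2 u x⁻¹ _ rfl h'',
    J_odd h2 u x⁻¹ _ rfl h'', e]
  obtain ⟨d, hd⟩ : ∃ d, d = 1 - u * x := ⟨_, rfl⟩
  obtain ⟨c, hc⟩ : ∃ c, c = x - u := ⟨_, rfl⟩
  rw [← hd] at h ⊢
  rw [← hc] at h' ⊢
  field_simp
  rw [hd, hc]
  ring

theorem braid_aux {K : Type*} [Field K] (h2 : (2 : K) ≠ 0) (u x y A B C D : K)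
    (x1 : 1 - u * x ≠ 0) (x2 : 1 + u * x ≠ 0) (y1 : 1 - u * y ≠ 0) (y2 : 1 + u * y ≠ 0)
    (z1 : 1 - u * (x * y) ≠ 0) (z2 : 1 + u * (x * y) ≠ 0) (J : K → ℕ → K)
    (hJ : ∀ y e, J y e = y / 2 * ((u - y) / (1 - u * y) - (-1) ^ e)) :
    A * J y 0 * J (x * y) 0 * J x 0 + C * J (-y) 0 * J (-(x * y)) 0 * J x 1 +
      (D * J (-y) 0 * J (x * y) 1 * J x 0 + B * J y 0 * J (-(x * y)) 1 * J x 1) +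
      (B * J y 1 * J (x * y) 0 * J x 0 + D * J (-y) 1 * J (-(x * y)) 0 * J x 1 +
      (C * J (-y) 1 * J (x * y) 1 * J x 0 + A * J y 1 * J (-(x * y)) 1 * J x 1)) =
    A * J x 0 * J (x * y) 0 * J y 0 + B * J (-x) 0 * J (-(x * y)) 0 * J y 1 +
      (D * J (-x) 0 * J (x * y) 1 * J y 0 + C * J x 0 * J (-(x * y)) 1 * J y 1) +
      (C * J x 1 * J (x * y) 0 * J y 0 + D * J (-x) 1 * J (-(x * y)) 0 * J y 1 +
      (B * J (-x) 1 * J (x * y) 1 * J y 0 + A * J x 1 * J (-(x * y)) 1 * J y 1)) := by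
  have h0 : ∀ y d, d = 1 - u * y → d ≠ 0 → J y 0 = y * (u - 1) * (1 + y) / (2 * d) :=
    fun y d hd h => by rw [hJ, ← hd, J_even h2 u y d hd h]
  have h1 : ∀ y d, d = 1 - u * y → d ≠ 0 → J y 1 = y * (u + 1) * (1 - y) / (2 * d) :=
    fun y d hd h => by rw [hJ, ← hd, J_odd h2 u y d hd h]
  obtain ⟨a, ha⟩ : ∃ a, a = 1 - u * x := ⟨_, rfl⟩
  obtain ⟨a', ha'⟩ : ∃ a', a' = 1 + u * x := ⟨_, rfl⟩
  obtain ⟨b, hb⟩ : ∃ b, b = 1 - u * y := ⟨_, rfl⟩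
  obtain ⟨b', hb'⟩ : ∃ b', b' = 1 + u * y := ⟨_, rfl⟩
  obtain ⟨c, hc⟩ : ∃ c, c = 1 - u * (x * y) := ⟨_, rfl⟩
  obtain ⟨c', hc'⟩ : ∃ c', c' = 1 + u * (x * y) := ⟨_, rfl⟩
  rw [← ha] at x1
  rw [← ha'] at x2
  rw [← hb] at y1
  rw [← hb'] at y2
  rw [← hc] at z1
  rw [← hc'] at z2
  rw [h0 x a ha x1, h1 x a ha x1, h0 y b hb y1, h1 y b hb y1, h0 (x * y) c hc z1,
    h1 (x * y) c hc z1, h0 (-x) a' (by rw [ha']; ring) x2, h1 (-x) a' (by rw [ha']; ring) x2,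
    h0 (-y) b' (by rw [hb']; ring) y2, h1 (-y) b' (by rw [hb']; ring) y2,
    h0 (-(x * y)) c' (by rw [hc']; ring) z2, h1 (-(x * y)) c' (by rw [hc']; ring) z2]
  field_simp
  rw [ha, ha', hb, hb', hc, hc']
  ring

/-! ### The Weyl group and the root lattice of a simply laced Dynkin diagram -/

/-- The Coxeter matrix of a simply laced diagram: `m i j = 3` if `i ∼ j`, and `2` otherwise. -/
def coxeterMatrix : CoxeterMatrix I where
  M := Matrix.of fun i j => if i = j then 1 else if Γ.Adj i j then 3 else 2
  isSymm := by
    ext i j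
    simp only [Matrix.transpose_apply, Matrix.of_apply, eq_comm (a := j) (b := i), Γ.adj_comm j i]
  diagonal := by simp
  off_diagonal := by
    intro i j h
    simp only [Matrix.of_apply, h, if_false]
    split_ifs <;> simp

/-- The Weyl group of the diagram, with generators the simple reflections `σ i`. -/
abbrev WeylGroup : Type _ := (coxeterMatrix Γ).Group

/-- `nbrSum Γ i a` is `v_i(a) = ∑_{j ∼ i} a j`. -/
def nbrSum (i : I) (a : I → ℤ) : ℤ := ∑ j ∈ Γ.neighborFinset i, a j

/-- The simple reflection `σ i` on the root lattice `⊕ ℤ α_j`: it sends `α_i` to `-α_i`, it sends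
`α_j` to `α_i + α_j` if `j ∼ i`, and it fixes the other `α_j`. -/
def reflect (i : I) (a : I → ℤ) : I → ℤ := a + Pi.single i (nbrSum Γ i a - 2 * a i)

theorem nbrSum_add (i : I) (a b : I → ℤ) : nbrSum Γ i (a + b) = nbrSum Γ i a + nbrSum Γ i b := by
  simp [nbrSum, Finset.sum_add_distrib]

theorem nbrSum_single (i j : I) (n : ℤ) :
    nbrSum Γ i (Pi.single j n) = if Γ.Adj i j then n else 0 := by
  simp [nbrSum]

theorem reflect_reflect (i : I) (a : I → ℤ) : reflect Γ i (reflect Γ i a) = a := by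
  ext k
  simp only [reflect, nbrSum_add, nbrSum_single, SimpleGraph.irrefl, if_false, Pi.add_apply,
    Pi.single_apply]
  by_cases h : k = i
  · subst h; simp; ring
  · simp [h]

/-- The simple reflection as an automorphism of the root lattice. -/
def reflectEquiv (i : I) : (I → ℤ) ≃+ (I → ℤ) where
  toFun := reflect Γ i
  invFun := reflect Γ i
  left_inv := reflect_reflect Γ i
  right_inv := reflect_reflect Γ i
  map_add' a b := by
    ext k
    simp only [reflect, nbrSum_add, Pi.add_apply, Pi.single_apply]
    split_ifs <;> ring

/-- Real roots: the Weyl group orbits of the simple roots. -/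
inductive IsRealRoot : (I → ℤ) → Prop
  | simple (i : I) : IsRealRoot (Pi.single i 1)
  | reflect (i : I) (b : I → ℤ) : IsRealRoot b → IsRealRoot (reflect Γ i b)

/-- Positive real roots. -/
def IsPosRealRoot (b : I → ℤ) : Prop := IsRealRoot Γ b ∧ ∀ i, 0 ≤ b i

/-! ### Rational functions in `x_i` (`i ∈ I`) and `u` -/

/-- The ring `ℂ[u][x_i, x_i⁻¹ : i ∈ I]`; its element `single a p` is `p(u) x^a`. -/
abbrev Laurent (I : Type*) : Type _ := ℂ[X][I → ℤ]

/-- The field `ℂ(x, u)`. -/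
abbrev RatFun (I : Type*) [Fintype I] : Type _ := FractionRing (Laurent I)

/-- The monomial `x^a = ∏ x_i ^ a i`, a rational function. -/
def mono (a : I → ℤ) : RatFun I :=
  algebraMap (Laurent I) (RatFun I) (AddMonoidAlgebra.single a 1)

/-- A polynomial `p(u)`, as a rational function of `x` and `u`. -/
def ofPoly (p : ℂ[X]) : RatFun I :=
  algebraMap (Laurent I) (RatFun I) (AddMonoidAlgebra.single 0 p)

/-- The substitution `x ↦ σ i x` on Laurent polynomials: it maps `x^a` to `x^(σ i a)`. -/
def reflL (i : I) : Laurent I →+* Laurent I :=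
  (AddMonoidAlgebra.domCongr ℂ[X] ℂ[X] (reflectEquiv Γ i)).toAlgHom.toRingHom

/-- The substitution `x ↦ ε i x` on Laurent polynomials, that is `x_j ↦ -x_j` for `j ∼ i`:
it maps `x^a` to `(-1) ^ v_i(a) x^a`. -/
def signL (i : I) : Laurent I →+* Laurent I :=
  (AddMonoidAlgebra.lift ℂ[X] (Laurent I) (I → ℤ)
    { toFun := fun a => AddMonoidAlgebra.single a.toAdd
        (((nbrSum Γ i a.toAdd).negOnePow : ℤ) : ℂ[X])
      map_one' := by simp [nbrSum, AddMonoidAlgebra.one_def]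
      map_mul' := fun a b => by
        simp [nbrSum_add, Int.negOnePow_add, AddMonoidAlgebra.single_mul_single] }).toRingHom

theorem reflL_single (i : I) (a : I → ℤ) (p : ℂ[X]) :
    reflL Γ i (AddMonoidAlgebra.single a p) = AddMonoidAlgebra.single (reflect Γ i a) p := by
  simp [reflL, reflectEquiv]

theorem signL_single (i : I) (a : I → ℤ) (p : ℂ[X]) :
    signL Γ i (AddMonoidAlgebra.single a p) = AddMonoidAlgebra.single a
      ((((nbrSum Γ i a).negOnePow : ℤ) : ℂ[X]) * p) := by
  simp [signL, AddMonoidAlgebra.lift_single, mul_comm]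

theorem reflL_injective (i : I) : Function.Injective (reflL Γ i) :=
  (AddMonoidAlgebra.domCongr ℂ[X] ℂ[X] (reflectEquiv Γ i)).injective

theorem signL_signL (i : I) (f : Laurent I) : signL Γ i (signL Γ i f) = f := by
  have : (signL Γ i).comp (signL Γ i) = RingHom.id _ := by
    refine AddMonoidAlgebra.ringHom_ext (fun r => ?_) (fun a => ?_) <;>
    · simp only [RingHom.comp_apply, signL_single, RingHom.id_apply, ← mul_assoc]
      congr 1
      rw [← Int.cast_mul, ← Units.val_mul, Int.units_mul_self]
      simp
  exact DFunLike.congr_fun this f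

theorem signL_injective (i : I) : Function.Injective (signL Γ i) :=
  Function.LeftInverse.injective (signL_signL Γ i)

/-- The substitution `f(x; u) ↦ f(σ i x; u)` on rational functions. -/
def refl (i : I) : RatFun I →+* RatFun I := IsFractionRing.map (reflL_injective Γ i)

/-- The substitution `f(x; u) ↦ f(ε i x; u)` on rational functions. -/
def sgn (i : I) : RatFun I →+* RatFun I := IsFractionRing.map (signL_injective Γ i)

/-- The variable `x_i`, as a rational function. -/
abbrev xvar (i : I) : RatFun I := mono (Pi.single i 1)

/-- The variable `u`, as a rational function. -/
abbrev uvar : RatFun I := ofPoly Polynomial.X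

/-- `J(y, e) = (y / 2) ((u - y) / (1 - u y) - (-1) ^ e)`. -/
def J (y : RatFun I) (e : ℕ) : RatFun I :=
  y / 2 * ((uvar - y) / (1 - uvar * y) - (-1) ^ e)

/-- The Chinta--Gunnells action of a simple reflection,
`f|σ i (x; u) = f(σ i x; u) J(x_i, 0) + f(ε i σ i x; u) J(x_i, 1)`. -/
def simpleSlash (i : I) : AddMonoid.End (RatFun I) where
  toFun f := refl Γ i f * J (xvar i) 0 + refl Γ i (sgn Γ i f) * J (xvar i) 1
  map_zero' := by simp
  map_add' f g := by simp only [map_add]; ring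

theorem refl_mono (i : I) (a : I → ℤ) : refl Γ i (mono a) = mono (reflect Γ i a) := by
  simp [refl, mono, IsFractionRing.map, IsLocalization.map_eq, reflL_single]

theorem refl_ofPoly (i : I) (p : ℂ[X]) : refl Γ i (ofPoly p) = ofPoly p := by
  have : reflect Γ i 0 = 0 := (reflectEquiv Γ i).map_zero
  simp [refl, ofPoly, IsFractionRing.map, IsLocalization.map_eq, reflL_single, this]

theorem sgn_mono (i : I) (a : I → ℤ) :
    sgn Γ i (mono a) = ((nbrSum Γ i a).negOnePow : ℤ) * mono a := by
  have h : (AddMonoidAlgebra.single a (((nbrSum Γ i a).negOnePow : ℤ) : ℂ[X]) : Laurent I) =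
      (((nbrSum Γ i a).negOnePow : ℤ) : Laurent I) * AddMonoidAlgebra.single a 1 := by
    rw [← zsmul_eq_mul, AddMonoidAlgebra.smul_single, zsmul_eq_mul, mul_one]
  simp only [sgn, mono, IsFractionRing.map, IsLocalization.map_eq, signL_single, mul_one]
  rw [h, map_mul, map_intCast]

theorem sgn_ofPoly (i : I) (p : ℂ[X]) : sgn Γ i (ofPoly p) = ofPoly p := by
  simp [sgn, ofPoly, IsFractionRing.map, IsLocalization.map_eq, signL_single, nbrSum]

theorem mono_add (a b : I → ℤ) : (mono (a + b) : RatFun I) = mono a * mono b := by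
  rw [mono, mono, mono, ← map_mul, AddMonoidAlgebra.single_mul_single, one_mul]

theorem mono_zero : (mono 0 : RatFun I) = 1 := map_one _

theorem mono_ne_zero (a : I → ℤ) : (mono a : RatFun I) ≠ 0 := by
  intro h
  have := mono_add a (-a)
  rw [add_neg_cancel, mono_zero, h, zero_mul] at this
  exact one_ne_zero this

theorem ratFun_ext {φ ψ : RatFun I →+* RatFun I} (h₁ : ∀ p : ℂ[X], φ (ofPoly p) = ψ (ofPoly p))
    (h₂ : ∀ a : I → ℤ, φ (mono a) = ψ (mono a)) (f : RatFun I) : φ f = ψ f := by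
  have : φ = ψ := by
    refine IsLocalization.ringHom_ext (nonZeroDivisors (Laurent I)) ?_
    exact AddMonoidAlgebra.ringHom_ext h₁ h₂
  rw [this]

theorem refl_refl (i : I) (f : RatFun I) : refl Γ i (refl Γ i f) = f :=
  ratFun_ext (φ := (refl Γ i).comp (refl Γ i)) (ψ := RingHom.id _)
    (fun p => by simp [refl_ofPoly]) (fun a => by simp [refl_mono, reflect_reflect]) f

theorem sgn_sgn (i : I) (f : RatFun I) : sgn Γ i (sgn Γ i f) = f :=
  ratFun_ext (φ := (sgn Γ i).comp (sgn Γ i)) (ψ := RingHom.id _)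
    (fun p => by simp [sgn_ofPoly])
    (fun a => by
      simp only [RingHom.comp_apply, sgn_mono, map_mul, map_intCast, RingHom.id_apply,
        ← mul_assoc]
      rw [← Int.cast_mul, ← Units.val_mul, Int.units_mul_self]
      simp) f

theorem sgn_comm (i j : I) (f : RatFun I) : sgn Γ i (sgn Γ j f) = sgn Γ j (sgn Γ i f) :=
  ratFun_ext (φ := (sgn Γ i).comp (sgn Γ j)) (ψ := (sgn Γ j).comp (sgn Γ i))
    (fun p => by simp [sgn_ofPoly])
    (fun a => by
      simp only [RingHom.comp_apply, sgn_mono, map_mul, map_intCast]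
      ring) f

theorem nbrSum_reflect (i j : I) (a : I → ℤ) :
    nbrSum Γ j (reflect Γ i a) =
      nbrSum Γ j a + if Γ.Adj j i then nbrSum Γ i a - 2 * a i else 0 := by
  rw [reflect, nbrSum_add, nbrSum_single]

theorem sgn_refl_of_not_adj (i j : I) (h : ¬ Γ.Adj j i) (f : RatFun I) :
    sgn Γ j (refl Γ i f) = refl Γ i (sgn Γ j f) :=
  ratFun_ext (φ := (sgn Γ j).comp (refl Γ i)) (ψ := (refl Γ i).comp (sgn Γ j))
    (fun p => by simp [sgn_ofPoly, refl_ofPoly])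
    (fun a => by
      simp [sgn_mono, refl_mono, nbrSum_reflect, h]) f

theorem sgn_refl_of_adj (i j : I) (h : Γ.Adj j i) (f : RatFun I) :
    sgn Γ j (refl Γ i f) = refl Γ i (sgn Γ i (sgn Γ j f)) :=
  ratFun_ext (φ := (sgn Γ j).comp (refl Γ i))
    (ψ := (refl Γ i).comp ((sgn Γ i).comp (sgn Γ j)))
    (fun p => by simp [sgn_ofPoly, refl_ofPoly])
    (fun a => by
      simp [sgn_mono, refl_mono, nbrSum_reflect, h, Int.negOnePow_add, Int.negOnePow_sub,
        Int.negOnePow_two_mul, mul_assoc]) f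

theorem refl_comm_of_not_adj (i j : I) (hij : i ≠ j) (h : ¬ Γ.Adj i j) (f : RatFun I) :
    refl Γ i (refl Γ j f) = refl Γ j (refl Γ i f) :=
  ratFun_ext (φ := (refl Γ i).comp (refl Γ j)) (ψ := (refl Γ j).comp (refl Γ i))
    (fun p => by simp [refl_ofPoly])
    (fun a => by
      have h' : ¬ Γ.Adj j i := fun k => h k.symm
      have : reflect Γ i (reflect Γ j a) = reflect Γ j (reflect Γ i a) := by
        ext k
        simp only [reflect, nbrSum_add, nbrSum_single, h, h', if_false, Pi.add_apply,
          Pi.single_apply, hij, hij.symm]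
        split_ifs <;> ring
      simp [refl_mono, this]) f

theorem refl_braid (i j : I) (h : Γ.Adj i j) (f : RatFun I) :
    refl Γ i (refl Γ j (refl Γ i f)) = refl Γ j (refl Γ i (refl Γ j f)) :=
  ratFun_ext (φ := (refl Γ i).comp ((refl Γ j).comp (refl Γ i)))
    (ψ := (refl Γ j).comp ((refl Γ i).comp (refl Γ j)))
    (fun p => by simp [refl_ofPoly])
    (fun a => by
      have hij := h.ne
      have : reflect Γ i (reflect Γ j (reflect Γ i a)) =
          reflect Γ j (reflect Γ i (reflect Γ j a)) := by
        ext k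
        simp only [reflect, nbrSum_add, nbrSum_single, h, h.symm, if_true, SimpleGraph.irrefl,
          if_false, Pi.add_apply, Pi.single_apply, hij, hij.symm]
        split_ifs <;> ring
      simp [refl_mono, this]) f

theorem refl_xvar_self (i : I) : refl Γ i (xvar i) = (xvar i)⁻¹ := by
  have h : reflect Γ i (Pi.single i 1) = -Pi.single i 1 := by
    ext k
    simp only [reflect, nbrSum_single, SimpleGraph.irrefl, if_false, Pi.add_apply, Pi.neg_apply,
      Pi.single_apply]
    split_ifs <;> simp
  rw [refl_mono, h]
  refine eq_inv_of_mul_eq_one_left ?_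
  rw [← mono_add, neg_add_cancel, mono_zero]

theorem refl_xvar_of_adj (i j : I) (hij : Γ.Adj i j) :
    refl Γ i (xvar j) = xvar i * xvar j := by
  have h : reflect Γ i (Pi.single j 1) = Pi.single i 1 + Pi.single j 1 := by
    ext k
    have hne := hij.ne
    simp only [reflect, nbrSum_single, hij, if_true, Pi.add_apply, Pi.single_apply, hne]
    split_ifs <;> simp_all
  rw [refl_mono, h, mono_add]

theorem refl_xvar_of_not_adj (i j : I) (hne : i ≠ j) (hij : ¬ Γ.Adj i j) :
    refl Γ i (xvar j) = xvar j := by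
  have h : reflect Γ i (Pi.single j 1) = Pi.single j 1 := by
    ext k
    simp only [reflect, nbrSum_single, hij, if_false, Pi.add_apply, Pi.single_apply, hne]
    split_ifs <;> simp
  rw [refl_mono, h]

theorem sgn_xvar_of_adj (i j : I) (hij : Γ.Adj i j) : sgn Γ i (xvar j) = -xvar j := by
  rw [sgn_mono, nbrSum_single, if_pos hij]
  simp

theorem sgn_xvar_of_not_adj (i j : I) (hij : ¬ Γ.Adj i j) : sgn Γ i (xvar j) = xvar j := by
  rw [sgn_mono, nbrSum_single, if_neg hij]
  simp

theorem uvar_mul_mono_ne (a : I → ℤ) (c : ℂ[X]) (hc : c.natDegree = 0) :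
    (uvar * mono a : RatFun I) ≠ ofPoly c := by
  intro h
  have h1 : (AddMonoidAlgebra.single a Polynomial.X : Laurent I) = AddMonoidAlgebra.single 0 c := by
    apply IsFractionRing.injective (Laurent I) (RatFun I)
    rw [← zero_add a, ← mul_one Polynomial.X, ← AddMonoidAlgebra.single_mul_single, map_mul]
    exact h
  have h2 := congrArg (fun f : Laurent I => f.coeff a) h1
  simp only [AddMonoidAlgebra.coeff_single, Finsupp.single_apply] at h2
  rw [if_pos trivial] at h2
  split_ifs at h2
  · rw [← h2, Polynomial.natDegree_X] at hc
    exact one_ne_zero hc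
  · exact Polynomial.X_ne_zero h2

theorem ofPoly_one : (ofPoly 1 : RatFun I) = 1 := map_one _

theorem ofPoly_neg_one : (ofPoly (-1) : RatFun I) = -1 := by
  rw [ofPoly, AddMonoidAlgebra.single_neg, map_neg]
  exact congrArg _ (map_one _)

theorem one_sub_ne_zero (a : I → ℤ) : (1 - uvar * mono a : RatFun I) ≠ 0 := by
  intro h
  refine uvar_mul_mono_ne a 1 (by simp) ?_
  rw [ofPoly_one]
  exact (sub_eq_zero.mp h).symm

theorem one_add_ne_zero (a : I → ℤ) : (1 + uvar * mono a : RatFun I) ≠ 0 := by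
  intro h
  refine uvar_mul_mono_ne a (-1) (by simp) ?_
  rw [ofPoly_neg_one]
  linear_combination h

theorem two_ne_zero' : (2 : RatFun I) ≠ 0 := by
  rw [← map_ofNat (algebraMap ℂ (RatFun I)) 2]
  exact (map_ne_zero _).mpr two_ne_zero

theorem map_J (φ : RatFun I →+* RatFun I) (hφ : φ uvar = uvar) (y : RatFun I) (e : ℕ) :
    φ (J y e) = J (φ y) e := by
  have h2 : φ 2 = 2 := map_ofNat φ 2
  simp only [J, map_mul, map_div₀, map_sub, map_pow, map_neg, map_one, hφ, h2]

theorem refl_J (i : I) (y : RatFun I) (e : ℕ) : refl Γ i (J y e) = J (refl Γ i y) e :=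
  map_J _ (refl_ofPoly Γ i _) y e

theorem sgn_J (i : I) (y : RatFun I) (e : ℕ) : sgn Γ i (J y e) = J (sgn Γ i y) e :=
  map_J _ (sgn_ofPoly Γ i _) y e

theorem simpleSlash_apply (i : I) (f : RatFun I) :
    simpleSlash Γ i f = refl Γ i f * J (xvar i) 0 + refl Γ i (sgn Γ i f) * J (xvar i) 1 := rfl

theorem simpleSlash_simpleSlash (i : I) (f : RatFun I) :
    simpleSlash Γ i (simpleSlash Γ i f) = f := by
  have hi : ¬ Γ.Adj i i := Γ.irrefl
  simp only [simpleSlash_apply, map_add, map_mul, refl_J, sgn_J, sgn_refl_of_not_adj Γ i i hi,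
    refl_refl, sgn_sgn, sgn_xvar_of_not_adj Γ i i hi, refl_xvar_self]
  have hx : (xvar i : RatFun I) ≠ 0 := mono_ne_zero _
  have h1 : (1 - uvar * xvar i : RatFun I) ≠ 0 := one_sub_ne_zero _
  have h2 : (xvar i - uvar : RatFun I) ≠ 0 := by
    have h := one_sub_ne_zero (-Pi.single i (1 : ℤ))
    contrapose! h
    rw [← sub_eq_zero.mp h, ← mono_add, add_neg_cancel, mono_zero, sub_self]
  exact square_aux two_ne_zero' uvar (xvar i) f (sgn Γ i f) hx h1 h2 J fun _ _ => rfl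

theorem simpleSlash_comm (i j : I) (hij : i ≠ j) (h : ¬ Γ.Adj i j) (f : RatFun I) :
    simpleSlash Γ i (simpleSlash Γ j f) = simpleSlash Γ j (simpleSlash Γ i f) := by
  have h' : ¬ Γ.Adj j i := fun k => h k.symm
  simp only [simpleSlash_apply, map_add, map_mul, refl_J, sgn_J, sgn_refl_of_not_adj Γ i j h',
    sgn_refl_of_not_adj Γ j i h, sgn_xvar_of_not_adj Γ i j h, sgn_xvar_of_not_adj Γ j i h',
    refl_xvar_of_not_adj Γ i j hij h, refl_xvar_of_not_adj Γ j i hij.symm h',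
    refl_comm_of_not_adj Γ i j hij h, sgn_comm Γ i j]
  ring

theorem simpleSlash_braid (i j : I) (h : Γ.Adj i j) (f : RatFun I) :
    simpleSlash Γ i (simpleSlash Γ j (simpleSlash Γ i f)) =
      simpleSlash Γ j (simpleSlash Γ i (simpleSlash Γ j f)) := by
  have h' := h.symm
  have hi : ¬ Γ.Adj i i := Γ.irrefl
  have hj : ¬ Γ.Adj j j := Γ.irrefl
  simp only [simpleSlash_apply, map_add, map_mul, map_neg, refl_J, sgn_J,
    sgn_refl_of_adj Γ i j h', sgn_refl_of_adj Γ j i h,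
    sgn_refl_of_not_adj Γ i i hi, sgn_refl_of_not_adj Γ j j hj, sgn_sgn,
    sgn_xvar_of_not_adj Γ i i hi, sgn_xvar_of_not_adj Γ j j hj,
    sgn_xvar_of_adj Γ i j h, sgn_xvar_of_adj Γ j i h',
    refl_xvar_of_adj Γ i j h, refl_xvar_of_adj Γ j i h', refl_xvar_self,
    refl_braid Γ i j h, sgn_comm Γ j i]
  have hx : (xvar i : RatFun I) ≠ 0 := mono_ne_zero _
  have hy : (xvar j : RatFun I) ≠ 0 := mono_ne_zero _
  have x1 : (1 - uvar * xvar i : RatFun I) ≠ 0 := one_sub_ne_zero _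
  have x2 : (1 + uvar * xvar i : RatFun I) ≠ 0 := one_add_ne_zero _
  have y1 : (1 - uvar * xvar j : RatFun I) ≠ 0 := one_sub_ne_zero _
  have y2 : (1 + uvar * xvar j : RatFun I) ≠ 0 := one_add_ne_zero _
  have z1 : (1 - uvar * (xvar i * xvar j) : RatFun I) ≠ 0 := by
    rw [← mono_add]; exact one_sub_ne_zero _
  have z2 : (1 + uvar * (xvar i * xvar j) : RatFun I) ≠ 0 := by
    rw [← mono_add]; exact one_add_ne_zero _
  have e1 : (xvar i * xvar j * (xvar i)⁻¹ : RatFun I) = xvar j := by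
    rw [mul_comm, inv_mul_cancel_left₀ hx]
  have e2 : (xvar i * xvar j * (xvar j)⁻¹ : RatFun I) = xvar i := mul_inv_cancel_right₀ hy _
  have e3 : (xvar j * xvar i : RatFun I) = xvar i * xvar j := mul_comm _ _
  have key := fun A B C D => braid_aux (two_ne_zero' (I := I)) uvar (xvar i) (xvar j) A B C D
    x1 x2 y1 y2 z1 z2 J fun _ _ => rfl
  simp only [neg_mul, e1, e2, e3, neg_neg]
  exact key _ _ _ _

theorem isLiftable_simpleSlash :
    (coxeterMatrix Γ).IsLiftable fun i => MulOpposite.op (simpleSlash Γ i) := by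
  intro i j
  have hsq : ∀ k, MulOpposite.op (simpleSlash Γ k) * MulOpposite.op (simpleSlash Γ k) = 1 := by
    intro k
    refine MulOpposite.unop_injective ?_
    exact AddMonoidHom.ext fun f => simpleSlash_simpleSlash Γ k f
  simp only [coxeterMatrix, Matrix.of_apply]
  split_ifs with hij hadj
  · subst hij
    rw [pow_one, hsq]
  · have hb : MulOpposite.op (simpleSlash Γ i) * MulOpposite.op (simpleSlash Γ j) *
        MulOpposite.op (simpleSlash Γ i) = MulOpposite.op (simpleSlash Γ j) *
        MulOpposite.op (simpleSlash Γ i) * MulOpposite.op (simpleSlash Γ j) := by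
      refine MulOpposite.unop_injective ?_
      exact AddMonoidHom.ext fun f => simpleSlash_braid Γ i j hadj f
    have hS := hsq i
    have hT := hsq j
    generalize MulOpposite.op (simpleSlash Γ i) = S at hb hS ⊢
    generalize MulOpposite.op (simpleSlash Γ j) = T at hb hT ⊢
    calc (S * T) ^ 3 = (S * T * S) * (T * S * T) := by simp only [pow_succ, pow_zero]; noncomm_ring
      _ = (S * T * S) * (S * T * S) := by rw [hb]
      _ = S * (T * (S * S) * T) * S := by simp only [mul_assoc]
      _ = 1 := by rw [hS, mul_one, hT, mul_one, hS]
  · have hc : MulOpposite.op (simpleSlash Γ i) * MulOpposite.op (simpleSlash Γ j) =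
        MulOpposite.op (simpleSlash Γ j) * MulOpposite.op (simpleSlash Γ i) := by
      refine MulOpposite.unop_injective ?_
      exact AddMonoidHom.ext fun f => simpleSlash_comm Γ j i (Ne.symm hij) (fun h => hadj h.symm) f
    rw [(show Commute _ _ from hc).mul_pow, pow_two, pow_two, hsq, hsq, one_mul]

/-- The Chinta--Gunnells action as a right action: `f|(w w') = (f|w)|w'`. -/
def slashHom : WeylGroup Γ →* (AddMonoid.End (RatFun I))ᵐᵒᵖ :=
  (coxeterMatrix Γ).toCoxeterSystem.lift ⟨_, isLiftable_simpleSlash Γ⟩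

/-- `f|w`. -/
def slash (f : RatFun I) (w : WeylGroup Γ) : RatFun I := (slashHom Γ w).unop f

theorem slash_one (f : RatFun I) : slash Γ f 1 = f := by simp [slash]

theorem slash_mul (f : RatFun I) (w w' : WeylGroup Γ) :
    slash Γ f (w * w') = slash Γ (slash Γ f w) w' := by simp [slash]

theorem slash_simple (f : RatFun I) (i : I) :
    slash Γ f ((coxeterMatrix Γ).simple i) =
      refl Γ i f * J (xvar i) 0 + refl Γ i (sgn Γ i f) * J (xvar i) 1 := by
  rw [slash, slashHom, ← CoxeterMatrix.toCoxeterSystem_simple, CoxeterSystem.lift_apply_simple]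
  rfl

/-! ### Values of rational functions -/

/-- The value of `x^a` at the point `x` of the torus. -/
def monoVal (x : I → ℂˣ) (a : I → ℤ) : ℂˣ := ∏ i, x i ^ a i

/-- The value of a Laurent polynomial at the point `(x; u)`. -/
def laurentVal (x : I → ℂˣ) (u : ℂ) : Laurent I →+* ℂ :=
  AddMonoidAlgebra.liftNCRingHom (Polynomial.evalRingHom u)
    { toFun := fun a => ((monoVal x a.toAdd : ℂˣ) : ℂ)
      map_one' := by simp [monoVal]
      map_mul' := fun a b => by
        simp [monoVal, zpow_add, Finset.prod_mul_distrib] }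
    (fun _ _ => Commute.all _ _)

/-- `f` takes the value `z` at `(x; u)`: it can be written as `p / q` with Laurent polynomials
`p`, `q` such that `q(x; u) ≠ 0` and `p(x; u) / q(x; u) = z`. -/
def HasValueAt (f : RatFun I) (x : I → ℂˣ) (u z : ℂ) : Prop :=
  ∃ p q : Laurent I, laurentVal x u q ≠ 0 ∧ f * algebraMap _ _ q = algebraMap _ _ p ∧
    z = laurentVal x u p / laurentVal x u q

/-- `f` has no pole at `(x; u)`. -/
def IsRegularAt (f : RatFun I) (x : I → ℂˣ) (u : ℂ) : Prop := ∃ z, HasValueAt f x u z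

theorem HasValueAt.unique {f : RatFun I} {x : I → ℂˣ} {u z z' : ℂ} (h : HasValueAt f x u z)
    (h' : HasValueAt f x u z') : z = z' := by
  obtain ⟨p, q, hq, hf, rfl⟩ := h
  obtain ⟨p', q', hq', hf', rfl⟩ := h'
  have : p * q' = p' * q := by
    apply IsFractionRing.injective (Laurent I) (RatFun I)
    rw [map_mul, map_mul, ← hf, ← hf']
    ring
  rw [div_eq_div_iff hq hq', ← map_mul, ← map_mul, this]

open Classical in
/-- The value `f(x; u)`; by convention it is `0` if `f` is not regular at `(x; u)`. -/
def value (f : RatFun I) (x : I → ℂˣ) (u : ℂ) : ℂ :=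
  if h : IsRegularAt f x u then h.choose else 0

theorem HasValueAt.value_eq {f : RatFun I} {x : I → ℂˣ} {u z : ℂ} (h : HasValueAt f x u z) :
    value f x u = z := by
  have h' : IsRegularAt f x u := ⟨z, h⟩
  rw [value, dif_pos h']
  exact h'.choose_spec.unique h

/-! ### Type `D₄⁽¹⁾` -/

/-- The Dynkin diagram of type `D₄⁽¹⁾`: the vertex `4` is joined to each of `0, 1, 2, 3`. -/
def affineD4 : SimpleGraph (Fin 5) where
  Adj i j := (i = 4 ∧ j ≠ 4) ∨ (i ≠ 4 ∧ j = 4)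
  symm := ⟨fun i j h => by tauto⟩
  loopless := ⟨fun i h => by tauto⟩

instance : DecidableRel affineD4.Adj := fun i j =>
  inferInstanceAs (Decidable ((i = 4 ∧ j ≠ 4) ∨ (i ≠ 4 ∧ j = 4)))

/-- The minimal positive imaginary root. -/
def delta : Fin 5 → ℤ := ![1, 1, 1, 1, 2]

/-- The points with `|x^δ| < 1` and `u x^β ≠ ±1` for all positive real roots `β`. -/
def InRegion (x : Fin 5 → ℂˣ) (u : ℂ) : Prop :=
  ‖(monoVal x delta : ℂ)‖ < 1 ∧
    ∀ b, IsPosRealRoot affineD4 b → u * monoVal x b ≠ 1 ∧ u * monoVal x b ≠ -1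

/-- The average `Z_{W,g}(x; u) = ∑_{w ∈ W} (g|w)(x; u)` in type `D₄⁽¹⁾`. -/
def average (g : RatFun (Fin 5)) (x : Fin 5 → ℂˣ) (u : ℂ) : ℂ :=
  ∑' w : WeylGroup affineD4, value (slash affineD4 g w) x u

/-- The value `P(y; u)` of a Laurent polynomial in one variable with coefficients in `ℤ[u]`. -/
def evalCoeff (P : (ℤ[X])[T;T⁻¹]) (y : ℂˣ) (u : ℂ) : ℂ :=
  LaurentPolynomial.eval₂ (Polynomial.aeval u : ℤ[X] →ₐ[ℤ] ℂ).toRingHom y P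

/-- The `8`-tuple of the numbers `±(a₁-a₂)`, `±(a₅-a₁-a₂)`, `±(a₃+a₄-a₅)`, `±(a₃-a₄)`, ordered
decreasingly (with `a₁, …, a₅` written `a 0, …, a 4`). -/
def diffTuple (a : Fin 5 → ℤ) : List ℤ :=
  [a 0 - a 1, -(a 0 - a 1), a 4 - a 0 - a 1, -(a 4 - a 0 - a 1),
    a 2 + a 3 - a 4, -(a 2 + a 3 - a 4), a 2 - a 3, -(a 2 - a 3)].insertionSort (· ≥ ·)

/-- The order on monomials: the `8`-tuples are compared lexicographically. -/
def MonoLT (a b : Fin 5 → ℤ) : Prop := diffTuple a < diffTuple b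

/-- The step of the recursion at the vertex `i`: a finite list of pairs `(p, b)`, which stands for
the formula `C_a = ∑ p(u) C_b`. -/
def recursionStep (i : Fin 5) (a : Fin 5 → ℤ) : List (ℤ[X] × (Fin 5 → ℤ)) :=
  let v := nbrSum affineD4 i a
  let e : Fin 5 → ℤ := Pi.single i 1
  if Odd v then
    if 2 * a i = v + 1 then [] else [(-1, reflect affineD4 i a + e)]
  else
    if 2 * a i = v + 2 then [(Polynomial.X, a - e)]
    else [(Polynomial.X, reflect affineD4 i a + e), (Polynomial.X, a - e),
      (-1, reflect affineD4 i a + 2 • e)]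

/-- The recursion that determines the family `C_a`: it starts from `C_{nδ} = T ^ n`, and it applies
at each vertex `i` with `v_i(a) < 2 a_i`. -/
def SatisfiesRecursion (C : (Fin 5 → ℤ) → (ℤ[X])[T;T⁻¹]) : Prop :=
  (∀ n : ℤ, C (n • delta) = LaurentPolynomial.T n) ∧
    ∀ a i, nbrSum affineD4 i a < 2 * a i →
      C a = ((recursionStep i a).map fun t => LaurentPolynomial.C t.1 * C t.2).sum

end ChintaGunnells

end

set_option linter.unusedSectionVars false

noncomputable section

namespace ChintaGunnells

section General

variable {I : Type*} [Fintype I] [DecidableEq I] (Γ : SimpleGraph I) [DecidableRel Γ.Adj]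

/-! ### The action of the Weyl group on the root lattice -/

/-! The relations between averages come from one reflection. The identities `J(y,0) - J(y,1) = -y`
and `J(y,0) + J(y,1) = y(u-y)/(1-uy)` show that `σ_i` sends `x^a` to minus a monomial when `v_i(a)`
is odd. When `v_i(a)` is even, it sends `x^a - u x^(a-α_i)` to a combination of two monomials,
because the factor `1 - u x_i` cancels the denominator (`slash_mono_sigma_of_odd`,
`slash_mono_sigma_of_even`). Replacing `f` by `f|σ_i` only reindexes the sum over `W`, so each
identity is a linear relation between averages, and solving it for the average of `x^a` gives a step
of the recursion. The monomials `x^(nδ)` are fixed by all substitutions and factor out. The steps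
descend in a well-founded order, so every average is a Laurent polynomial in `x^δ` over `ℤ[u]` times
`Z_W`.

Convergence rests on inversion sets (`exists_inversionSet`): `x^a|w` is bounded by `|x^(w⁻¹a)|`
times a product, over `ℓ(w)` distinct positive real roots `β`, of factors that tend to `0` with
`x^β`. Real roots stay within bounded distance of `ℤδ`, so `|x^δ| < 1` makes all but finitely many
factors smaller than any prescribed `ε`. This beats both the exponential growth of `x^(w⁻¹a)`,
controlled by an invariant quadratic form, and the exponential number of elements of given length.

The recursion is overdetermined, as several vertices may apply to one `a`. Its consistency is not
checked combinatorially. A solution built from one chosen vertex per `a` computes the averages, and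
these satisfy the step at every vertex. Since `Z_W ≠ 0` near the origin on the diagonal, the two
sides of each step agree at enough points to be equal (`exists_satisfiesRecursion`).

For finite `W`, the orbit sum `h = ∑_w x^(2wα_i)` is fixed by all substitutions, so its average is
`h Z_W`. If every average of a monomial were a `ℂ(u)`-multiple of `Z_W ≠ 0`, then `h` would lie in
`ℂ(u)`, which its coefficient at `x^(2α_i)` excludes. -/

theorem reflect_comm_of_not_adj (i j : I) (hij : i ≠ j) (h : ¬ Γ.Adj i j) (a : I → ℤ) :
    reflect Γ i (reflect Γ j a) = reflect Γ j (reflect Γ i a) := by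
  have h' : ¬ Γ.Adj j i := fun k => h k.symm
  ext k
  simp only [reflect, nbrSum_add, nbrSum_single, h, h', if_false, Pi.add_apply,
    Pi.single_apply, hij, hij.symm]
  split_ifs <;> ring

theorem reflect_braid (i j : I) (h : Γ.Adj i j) (a : I → ℤ) :
    reflect Γ i (reflect Γ j (reflect Γ i a)) = reflect Γ j (reflect Γ i (reflect Γ j a)) := by
  have hij := h.ne
  ext k
  simp only [reflect, nbrSum_add, nbrSum_single, h, h.symm, if_true, SimpleGraph.irrefl,
    if_false, Pi.add_apply, Pi.single_apply, hij, hij.symm]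
  split_ifs <;> ring

/-- The simple reflection as an endomorphism of the root lattice. -/
def reflectEnd (i : I) : AddMonoid.End (I → ℤ) := (reflectEquiv Γ i).toAddMonoidHom

theorem isLiftable_reflectEnd : (coxeterMatrix Γ).IsLiftable (reflectEnd Γ) := by
  intro i j
  have hsq : ∀ k, reflectEnd Γ k * reflectEnd Γ k = 1 := fun k =>
    AddMonoidHom.ext fun a => reflect_reflect Γ k a
  simp only [coxeterMatrix, Matrix.of_apply]
  split_ifs with hij hadj
  · subst hij
    rw [pow_one, hsq]
  · have hb : reflectEnd Γ i * reflectEnd Γ j * reflectEnd Γ i =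
        reflectEnd Γ j * reflectEnd Γ i * reflectEnd Γ j :=
      AddMonoidHom.ext fun a => reflect_braid Γ i j hadj a
    have hS := hsq i
    have hT := hsq j
    generalize reflectEnd Γ i = S at hb hS ⊢
    generalize reflectEnd Γ j = T at hb hT ⊢
    calc (S * T) ^ 3 = (S * T * S) * (T * S * T) := by simp only [pow_succ, pow_zero]; noncomm_ring
      _ = (S * T * S) * (S * T * S) := by rw [hb]
      _ = S * (T * (S * S) * T) * S := by simp only [mul_assoc]
      _ = 1 := by rw [hS, mul_one, hT, mul_one, hS]
  · have hc : reflectEnd Γ i * reflectEnd Γ j = reflectEnd Γ j * reflectEnd Γ i :=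
      AddMonoidHom.ext fun a => reflect_comm_of_not_adj Γ i j hij hadj a
    rw [(show Commute _ _ from hc).mul_pow, pow_two, pow_two, hsq, hsq, one_mul]

/-- The action of the Weyl group on the root lattice. -/
def latticeHom : WeylGroup Γ →* AddMonoid.End (I → ℤ) :=
  (coxeterMatrix Γ).toCoxeterSystem.lift ⟨_, isLiftable_reflectEnd Γ⟩

/-- The simple reflection `σ i` in the Weyl group. -/
abbrev sigma (i : I) : WeylGroup Γ := (coxeterMatrix Γ).simple i

/-- The Coxeter system of the diagram. -/
abbrev coxSys : CoxeterSystem (coxeterMatrix Γ) (WeylGroup Γ) :=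
  (coxeterMatrix Γ).toCoxeterSystem

theorem latticeHom_sigma (i : I) (a : I → ℤ) : latticeHom Γ (sigma Γ i) a = reflect Γ i a := by
  rw [latticeHom, sigma, ← CoxeterMatrix.toCoxeterSystem_simple, CoxeterSystem.lift_apply_simple]
  rfl

theorem latticeHom_mul (w w' : WeylGroup Γ) (a : I → ℤ) :
    latticeHom Γ (w * w') a = latticeHom Γ w (latticeHom Γ w' a) := by
  rw [map_mul]
  rfl

theorem latticeHom_one (a : I → ℤ) : latticeHom Γ 1 a = a := by
  rw [map_one]
  rfl

theorem latticeHom_inv_apply (w : WeylGroup Γ) (a : I → ℤ) :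
    latticeHom Γ w⁻¹ (latticeHom Γ w a) = a := by
  rw [← latticeHom_mul, inv_mul_cancel, latticeHom_one]

theorem sigma_mul_self (i : I) : sigma Γ i * sigma Γ i = 1 :=
  (coxSys Γ).simple_mul_simple_self i

theorem sigma_inv (i : I) : (sigma Γ i)⁻¹ = sigma Γ i := (coxSys Γ).inv_simple i

theorem sigma_comm (i j : I) (hij : i ≠ j) (h : ¬ Γ.Adj i j) :
    sigma Γ i * sigma Γ j = sigma Γ j * sigma Γ i := by
  have := (coxSys Γ).simple_mul_simple_pow i j
  simp only [coxeterMatrix, Matrix.of_apply, hij, h, if_false, pow_two] at this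
  calc sigma Γ i * sigma Γ j = (sigma Γ i * sigma Γ j)⁻¹ := (inv_eq_of_mul_eq_one_right this).symm
    _ = _ := by rw [mul_inv_rev, sigma_inv, sigma_inv]

theorem sigma_braid (i j : I) (h : Γ.Adj i j) :
    sigma Γ i * sigma Γ j * sigma Γ i = sigma Γ j * sigma Γ i * sigma Γ j := by
  have := (coxSys Γ).simple_mul_simple_pow i j
  simp only [coxeterMatrix, Matrix.of_apply, h.ne, h, if_false, if_true] at this
  have e : (sigma Γ i * sigma Γ j) ^ 3 =
      (sigma Γ i * sigma Γ j * sigma Γ i) * (sigma Γ j * sigma Γ i * sigma Γ j) := by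
    simp only [pow_succ, pow_zero, one_mul, mul_assoc]
  rw [← inv_eq_of_mul_eq_one_left (e.symm.trans this)]
  simp only [mul_inv_rev, sigma_inv, mul_assoc]

theorem reflect_single_of_adj (i j : I) (hij : Γ.Adj i j) :
    reflect Γ i (Pi.single j 1) = Pi.single i 1 + Pi.single j 1 := by
  ext k
  have hne := hij.ne
  simp only [reflect, nbrSum_single, hij, if_true, Pi.add_apply, Pi.single_apply, hne]
  split_ifs <;> simp_all

theorem reflect_single_of_not_adj (i j : I) (hne : i ≠ j) (hij : ¬ Γ.Adj i j) :
    reflect Γ i (Pi.single j 1) = Pi.single j 1 := by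
  ext k
  simp only [reflect, nbrSum_single, hij, if_false, Pi.add_apply, Pi.single_apply, hne]
  split_ifs <;> simp

theorem reflect_single_self (i : I) : reflect Γ i (Pi.single i 1) = -Pi.single i 1 := by
  ext k
  simp only [reflect, nbrSum_single, SimpleGraph.irrefl, if_false, Pi.add_apply, Pi.neg_apply,
    Pi.single_apply]
  split_ifs <;> simp

/-! ### Positivity of roots -/

/-- If `w σ_i` is longer than `w`, then `w α_i` is a positive root. -/
theorem latticeHom_single_nonneg (w : WeylGroup Γ) (i : I)
    (h : ¬ (coxSys Γ).IsRightDescent w i) : 0 ≤ latticeHom Γ w (Pi.single i 1) := by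
  induction hn : (coxSys Γ).length w using Nat.strong_induction_on generalizing w i with
  | _ n ih =>
    subst hn
    by_cases hw : w = 1
    · subst hw
      rw [latticeHom_one]
      exact Pi.single_nonneg.mpr zero_le_one
    obtain ⟨j, hj⟩ := (coxSys Γ).exists_rightDescent_of_ne_one hw
    have hij : i ≠ j := fun e => h (e ▸ hj)
    obtain ⟨v, rfl⟩ : ∃ v, w = v * sigma Γ j :=
      ⟨w * sigma Γ j, by rw [mul_assoc, sigma_mul_self, mul_one]⟩
    have hvj : ¬ (coxSys Γ).IsRightDescent v j := by
      have := ((coxSys Γ).isRightDescent_iff_not_isRightDescent_mul).mp hj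
      rwa [CoxeterMatrix.toCoxeterSystem_simple, mul_assoc, sigma_mul_self, mul_one] at this
    have hlv : (coxSys Γ).length (v * sigma Γ j) = (coxSys Γ).length v + 1 :=
      ((coxSys Γ).not_isRightDescent_iff).mp hvj
    have hli : (coxSys Γ).length (v * sigma Γ j * sigma Γ i) = (coxSys Γ).length v + 1 + 1 := by
      rw [← hlv]; exact ((coxSys Γ).not_isRightDescent_iff).mp h
    have hle : ∀ (x : WeylGroup Γ) k,
        (coxSys Γ).length (x * sigma Γ k) ≤ (coxSys Γ).length x + 1 := fun x k => by
      rcases (coxSys Γ).length_mul_simple x k with e | e <;>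
      · rw [CoxeterMatrix.toCoxeterSystem_simple] at e
        show (coxSys Γ).length (x * (coxeterMatrix Γ).simple k) ≤ _
        omega
    rw [latticeHom_mul, latticeHom_sigma]
    by_cases hadj : Γ.Adj j i
    · rw [reflect_single_of_adj Γ j i hadj, map_add]
      -- Here `w α_i = v α_i + v α_j`. If `v = v'σ_i` is itself shortened by `σ_i`, the sum
      -- collapses to `v' α_j`. A descent of `v'` at `j` is impossible, since the braid relation
      -- would bring `w σ_i = v'σ_jσ_iσ_j` down to length at most `ℓ(v') + 1` instead of `ℓ(v') +
      -- 3`.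
      by_cases hvi : (coxSys Γ).IsRightDescent v i
      · obtain ⟨v', rfl⟩ : ∃ v', v = v' * sigma Γ i :=
          ⟨v * sigma Γ i, by rw [mul_assoc, sigma_mul_self, mul_one]⟩
        have hlv' : (coxSys Γ).length (v' * sigma Γ i) = (coxSys Γ).length v' + 1 := by
          have := ((coxSys Γ).isRightDescent_iff).mp hvi
          rw [CoxeterMatrix.toCoxeterSystem_simple, mul_assoc, sigma_mul_self, mul_one] at this
          exact this.symm
        have e : v' * sigma Γ i * sigma Γ j * sigma Γ i =
            v' * sigma Γ j * sigma Γ i * sigma Γ j := by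
          rw [mul_assoc v', mul_assoc v', sigma_braid Γ i j hadj.symm]
          simp only [mul_assoc]
        have hv'j : ¬ (coxSys Γ).IsRightDescent v' j := by
          intro hd
          have h1 := ((coxSys Γ).isRightDescent_iff).mp hd
          rw [CoxeterMatrix.toCoxeterSystem_simple] at h1
          have h2 := hle (v' * sigma Γ j * sigma Γ i) j
          have h3 := hle (v' * sigma Γ j) i
          rw [e] at hli
          have h1' : (coxSys Γ).length (v' * sigma Γ j) + 1 = (coxSys Γ).length v' := h1
          omega
        have := ih _ (by omega) v' j hv'j rfl
        rw [latticeHom_mul, latticeHom_mul, latticeHom_sigma, latticeHom_sigma,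
          reflect_single_of_adj Γ i j hadj.symm, reflect_single_self, map_add, map_neg]
        simpa using this
      · exact add_nonneg (ih _ (by omega) v j hvj rfl) (ih _ (by omega) v i hvi rfl)
    · rw [reflect_single_of_not_adj Γ j i hij.symm hadj]
      -- Now `w α_i = v α_i`. A descent of `v` at `i` would give `w σ_i = vσ_iσ_j` length at most
      -- `ℓ(v)`, not `ℓ(v) + 2`.
      refine ih _ (by omega) v i (fun hd => ?_) rfl
      have h1 := ((coxSys Γ).isRightDescent_iff).mp hd
      rw [CoxeterMatrix.toCoxeterSystem_simple] at h1
      have h1' : (coxSys Γ).length (v * sigma Γ i) + 1 = (coxSys Γ).length v := h1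
      have h2 := hle (v * sigma Γ i) j
      rw [mul_assoc, sigma_comm Γ j i hij.symm hadj, ← mul_assoc] at hli
      omega

/-- If `w σ_i` is shorter than `w`, then `w α_i` is a negative root. -/
theorem latticeHom_single_nonpos (w : WeylGroup Γ) (i : I)
    (h : (coxSys Γ).IsRightDescent w i) : latticeHom Γ w (Pi.single i 1) ≤ 0 := by
  have h1 := ((coxSys Γ).isRightDescent_iff_not_isRightDescent_mul).mp h
  have := latticeHom_single_nonneg Γ _ i h1
  rw [latticeHom_mul] at this
  erw [latticeHom_sigma] at this
  rw [reflect_single_self, map_neg] at this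
  exact neg_nonneg.mp this

theorem isRealRoot_latticeHom (w : WeylGroup Γ) {b : I → ℤ} (hb : IsRealRoot Γ b) :
    IsRealRoot Γ (latticeHom Γ w b) := by
  induction w using (coxSys Γ).simple_induction_left with
  | one => rwa [latticeHom_one]
  | mul_simple_left w i ih =>
    rw [latticeHom_mul]
    erw [latticeHom_sigma]
    exact .reflect _ _ ih

theorem IsRealRoot.exists_latticeHom {b : I → ℤ} (hb : IsRealRoot Γ b) :
    ∃ (w : WeylGroup Γ) (i : I), b = latticeHom Γ w (Pi.single i 1) := by
  induction hb with
  | simple i => exact ⟨1, i, (latticeHom_one Γ _).symm⟩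
  | reflect i b _ ih =>
    obtain ⟨w, j, rfl⟩ := ih
    exact ⟨sigma Γ i * w, j, by rw [latticeHom_mul, latticeHom_sigma]⟩

theorem IsRealRoot.nonneg_or_nonpos {b : I → ℤ} (hb : IsRealRoot Γ b) : 0 ≤ b ∨ b ≤ 0 := by
  obtain ⟨w, i, rfl⟩ := hb.exists_latticeHom
  by_cases h : (coxSys Γ).IsRightDescent w i
  · exact .inr (latticeHom_single_nonpos Γ w i h)
  · exact .inl (latticeHom_single_nonneg Γ w i h)

theorem IsRealRoot.ne_zero {b : I → ℤ} (hb : IsRealRoot Γ b) : b ≠ 0 := by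
  obtain ⟨w, i, rfl⟩ := hb.exists_latticeHom
  intro h
  have := congrArg (latticeHom Γ w⁻¹) h
  rw [latticeHom_inv_apply, map_zero] at this
  simpa using congrFun this i

/-- Write `c α_i = w α_j`. Then `c · w⁻¹α_i = α_j`, so `c` divides `1`. -/
theorem IsRealRoot.single_eq {i : I} {c : ℤ} (h : IsRealRoot Γ (Pi.single i c)) (hc : 0 ≤ c) :
    c = 1 := by
  obtain ⟨w, j, h⟩ := h.exists_latticeHom
  have h1 := congrArg (latticeHom Γ w⁻¹) h
  have h2 : (Pi.single i c : I → ℤ) = c • Pi.single i 1 := by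
    ext k; simp [Pi.single_apply]
  rw [latticeHom_inv_apply, h2, map_zsmul] at h1
  have := congrFun h1 j
  simp only [Pi.smul_apply, smul_eq_mul, Pi.single_eq_same] at this
  exact Int.eq_one_of_mul_eq_one_right hc this

/-- A simple reflection permutes the positive real roots other than its own simple root. -/
theorem IsPosRealRoot.reflect {b : I → ℤ} (hb : IsPosRealRoot Γ b) (i : I)
    (h : b ≠ Pi.single i 1) : IsPosRealRoot Γ (reflect Γ i b) := by
  refine ⟨.reflect i b hb.1, ?_⟩
  rcases (IsRealRoot.reflect i b hb.1).nonneg_or_nonpos with h1 | h1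
  · exact h1
  · exfalso
    -- The reflection changes only the coordinate at `i`, so a sign change forces all other
    -- coordinates of `b` to vanish.
    have h2 : b = Pi.single i (b i) := by
      ext k
      by_cases hk : k = i
      · subst hk; simp
      · have h3 := h1 k
        simp only [ChintaGunnells.reflect, Pi.add_apply, Pi.single_apply, hk, if_false,
          Pi.zero_apply] at h3
        simp only [Pi.single_apply, hk, if_false]
        have := hb.2 k
        omega
    have h3 := hb.1
    rw [h2] at h3
    rw [h3.single_eq Γ (hb.2 i)] at h2
    exact h h2

end General

section General

variable {I : Type*} [Fintype I] [DecidableEq I] (Γ : SimpleGraph I) [DecidableRel Γ.Adj]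

/-! ### Values of rational functions and the action on points -/

theorem monoVal_add (x : I → ℂˣ) (a b : I → ℤ) :
    monoVal x (a + b) = monoVal x a * monoVal x b := by
  simp [monoVal, zpow_add, Finset.prod_mul_distrib]

theorem monoVal_zero (x : I → ℂˣ) : monoVal x 0 = 1 := by simp [monoVal]

theorem monoVal_single (x : I → ℂˣ) (i : I) (n : ℤ) : monoVal x (Pi.single i n) = x i ^ n := by
  rw [monoVal, Finset.prod_eq_single i]
  · simp
  · intro j _ hj
    simp [hj]
  · simp

/-- `a ↦ x^a` as a homomorphism. -/
def monoValHom (x : I → ℂˣ) : (I → ℤ) →+ Additive ℂˣ where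
  toFun a := Additive.ofMul (monoVal x a)
  map_zero' := by rw [monoVal_zero, ofMul_one]
  map_add' a b := by rw [monoVal_add, ofMul_mul]

theorem monoVal_zsmul (x : I → ℂˣ) (n : ℤ) (a : I → ℤ) : monoVal x (n • a) = monoVal x a ^ n :=
  map_zsmul (monoValHom x) n a

/-- The point `σ i x`. -/
def reflPoint (i : I) (x : I → ℂˣ) : I → ℂˣ := fun j => monoVal x (reflect Γ i (Pi.single j 1))

/-- The point `ε i x`. -/
def signPoint (i : I) (x : I → ℂˣ) : I → ℂˣ := fun j => if Γ.Adj i j then -x j else x j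

/-- Both sides are homomorphisms in `a`, so it suffices to compare them on simple roots. -/
theorem monoVal_reflPoint (i : I) (x : I → ℂˣ) (a : I → ℤ) :
    monoVal (reflPoint Γ i x) a = monoVal x (reflect Γ i a) := by
  have : monoValHom (reflPoint Γ i x) =
      (monoValHom x).comp (reflectEquiv Γ i).toAddMonoidHom := by
    refine AddMonoidHom.functions_ext' _ _ _ fun j => AddMonoidHom.ext_int ?_
    show Additive.ofMul (monoVal _ (Pi.single j 1)) =
      Additive.ofMul (monoVal x (reflect Γ i (Pi.single j 1)))
    rw [monoVal_single, zpow_one, reflPoint]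
  exact DFunLike.congr_fun this a

theorem monoVal_signPoint (i : I) (x : I → ℂˣ) (a : I → ℤ) :
    monoVal (signPoint Γ i x) a = (-1) ^ nbrSum Γ i a * monoVal x a := by
  have : ∀ j, signPoint Γ i x j ^ a j =
      (if j ∈ Γ.neighborFinset i then (-1 : ℂˣ) ^ a j else 1) * x j ^ a j := by
    intro j
    simp only [signPoint, SimpleGraph.mem_neighborFinset]
    split_ifs
    · rw [← mul_zpow, neg_one_mul]
    · rw [one_mul]
  rw [monoVal, Finset.prod_congr rfl fun j _ => this j, Finset.prod_mul_distrib, ← monoVal,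
    Finset.prod_ite_mem, Finset.univ_inter, nbrSum]
  congr 1
  generalize Γ.neighborFinset i = s
  induction s using Finset.induction_on with
  | empty => simp
  | insert j s hj ih => rw [Finset.prod_insert hj, Finset.sum_insert hj, zpow_add, ih]

theorem laurentVal_single (x : I → ℂˣ) (u : ℂ) (a : I → ℤ) (p : ℂ[X]) :
    laurentVal x u (AddMonoidAlgebra.single a p) = p.eval u * monoVal x a := by
  simp [laurentVal, AddMonoidAlgebra.liftNCRingHom, AddMonoidAlgebra.liftNC_single]

theorem laurentVal_reflL (i : I) (x : I → ℂˣ) (u : ℂ) (f : Laurent I) :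
    laurentVal x u (reflL Γ i f) = laurentVal (reflPoint Γ i x) u f := by
  have : (laurentVal x u).comp (reflL Γ i) = laurentVal (reflPoint Γ i x) u := by
    refine AddMonoidAlgebra.ringHom_ext (fun r => ?_) (fun a => ?_) <;>
    simp only [RingHom.comp_apply, reflL_single, laurentVal_single, monoVal_reflPoint]
  exact DFunLike.congr_fun this f

theorem laurentVal_signL (i : I) (x : I → ℂˣ) (u : ℂ) (f : Laurent I) :
    laurentVal x u (signL Γ i f) = laurentVal (signPoint Γ i x) u f := by
  have : (laurentVal x u).comp (signL Γ i) = laurentVal (signPoint Γ i x) u := by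
    refine AddMonoidAlgebra.ringHom_ext (fun r => ?_) (fun a => ?_)
    · simp [RingHom.comp_apply, signL_single, laurentVal_single, nbrSum, monoVal_zero]
    · simp only [RingHom.comp_apply, signL_single, laurentVal_single, monoVal_signPoint]
      rcases Int.even_or_odd (nbrSum Γ i a) with h | h
      · simp [h.neg_one_zpow, Int.negOnePow_even _ h]
      · simp [h.neg_one_zpow, Int.negOnePow_odd _ h]
  exact DFunLike.congr_fun this f

theorem hasValueAt_algebraMap (x : I → ℂˣ) (u : ℂ) (p : Laurent I) :
    HasValueAt (algebraMap _ _ p) x u (laurentVal x u p) :=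
  ⟨p, 1, by simp, by simp, by simp⟩

variable {x : I → ℂˣ} {u : ℂ} {f g : RatFun I} {z z' : ℂ}

theorem HasValueAt.add (hf : HasValueAt f x u z) (hg : HasValueAt g x u z') :
    HasValueAt (f + g) x u (z + z') := by
  obtain ⟨p, q, hq, h, rfl⟩ := hf
  obtain ⟨p', q', hq', h', rfl⟩ := hg
  refine ⟨p * q' + p' * q, q * q', by simp [hq, hq'], ?_, ?_⟩
  · simp only [map_mul, map_add, ← h, ← h']
    ring
  · simp only [map_mul, map_add]
    field_simp

theorem HasValueAt.mul (hf : HasValueAt f x u z) (hg : HasValueAt g x u z') :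
    HasValueAt (f * g) x u (z * z') := by
  obtain ⟨p, q, hq, h, rfl⟩ := hf
  obtain ⟨p', q', hq', h', rfl⟩ := hg
  refine ⟨p * p', q * q', by simp [hq, hq'], ?_, ?_⟩
  · simp only [map_mul, ← h, ← h']
    ring
  · simp only [map_mul]
    field_simp

theorem HasValueAt.neg (hf : HasValueAt f x u z) : HasValueAt (-f) x u (-z) := by
  obtain ⟨p, q, hq, h, rfl⟩ := hf
  exact ⟨-p, q, hq, by rw [map_neg, ← h, neg_mul], by rw [map_neg, neg_div]⟩

theorem HasValueAt.sub (hf : HasValueAt f x u z) (hg : HasValueAt g x u z') :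
    HasValueAt (f - g) x u (z - z') := by
  rw [sub_eq_add_neg, sub_eq_add_neg]
  exact hf.add hg.neg

theorem HasValueAt.inv (hf : HasValueAt f x u z) (hz : z ≠ 0) : HasValueAt f⁻¹ x u z⁻¹ := by
  obtain ⟨p, q, hq, h, rfl⟩ := hf
  have hp : laurentVal x u p ≠ 0 := fun e => hz (by rw [e, zero_div])
  have hp' : algebraMap (Laurent I) (RatFun I) p ≠ 0 := by
    intro e
    rw [← map_zero (algebraMap (Laurent I) (RatFun I))] at e
    exact hp (by rw [IsFractionRing.injective (Laurent I) (RatFun I) e, map_zero])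
  refine ⟨q, p, hp, ?_, inv_div _ _⟩
  have hf0 : f ≠ 0 := fun e => hp' (by rw [← h, e, zero_mul])
  rw [← h, inv_mul_cancel_left₀ hf0]

theorem HasValueAt.div (hf : HasValueAt f x u z) (hg : HasValueAt g x u z') (hz : z' ≠ 0) :
    HasValueAt (f / g) x u (z / z') := by
  rw [div_eq_mul_inv, div_eq_mul_inv]
  exact hf.mul (hg.inv hz)

theorem hasValueAt_mono (x : I → ℂˣ) (u : ℂ) (a : I → ℤ) :
    HasValueAt (mono a) x u (monoVal x a : ℂˣ) := by
  have := hasValueAt_algebraMap x u (AddMonoidAlgebra.single a 1)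
  rwa [laurentVal_single, Polynomial.eval_one, one_mul] at this

theorem hasValueAt_ofPoly (x : I → ℂˣ) (u : ℂ) (p : ℂ[X]) :
    HasValueAt (ofPoly p) x u (p.eval u) := by
  have := hasValueAt_algebraMap x u (AddMonoidAlgebra.single 0 p)
  rwa [laurentVal_single, monoVal_zero, Units.val_one, mul_one] at this

theorem hasValueAt_one (x : I → ℂˣ) (u : ℂ) : HasValueAt (1 : RatFun I) x u 1 := by
  simpa using hasValueAt_algebraMap x u 1

theorem hasValueAt_two (x : I → ℂˣ) (u : ℂ) : HasValueAt (2 : RatFun I) x u 2 := by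
  simpa only [map_ofNat] using hasValueAt_algebraMap x u 2

theorem hasValueAt_zero (x : I → ℂˣ) (u : ℂ) : HasValueAt (0 : RatFun I) x u 0 := by
  simpa using hasValueAt_algebraMap x u 0

theorem hasValueAt_neg_one_pow (x : I → ℂˣ) (u : ℂ) (e : ℕ) :
    HasValueAt ((-1) ^ e : RatFun I) x u ((-1) ^ e) := by
  simpa using hasValueAt_algebraMap x u ((-1) ^ e)

theorem HasValueAt.refl {i : I} (hf : HasValueAt f (reflPoint Γ i x) u z) :
    HasValueAt (refl Γ i f) x u z := by
  obtain ⟨p, q, hq, h, rfl⟩ := hf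
  refine ⟨reflL Γ i p, reflL Γ i q, by rwa [laurentVal_reflL], ?_, by
    rw [laurentVal_reflL, laurentVal_reflL]⟩
  have := congrArg (ChintaGunnells.refl Γ i) h
  rwa [map_mul, ChintaGunnells.refl, IsFractionRing.map, IsLocalization.map_eq,
    IsLocalization.map_eq] at this

theorem HasValueAt.sgn {i : I} (hf : HasValueAt f (signPoint Γ i x) u z) :
    HasValueAt (sgn Γ i f) x u z := by
  obtain ⟨p, q, hq, h, rfl⟩ := hf
  refine ⟨signL Γ i p, signL Γ i q, by rwa [laurentVal_signL], ?_, by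
    rw [laurentVal_signL, laurentVal_signL]⟩
  have := congrArg (ChintaGunnells.sgn Γ i) h
  rwa [map_mul, ChintaGunnells.sgn, IsFractionRing.map, IsLocalization.map_eq,
    IsLocalization.map_eq] at this

theorem HasValueAt.J (hf : HasValueAt f x u z) (h : 1 - u * z ≠ 0) (e : ℕ) :
    HasValueAt (J f e) x u (z / 2 * ((u - z) / (1 - u * z) - (-1) ^ e)) := by
  have hu : HasValueAt (uvar : RatFun I) x u u := by
    simpa using hasValueAt_ofPoly x u Polynomial.X
  exact (hf.div (hasValueAt_two x u) two_ne_zero).mul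
    (((hu.sub hf).div ((hasValueAt_one x u).sub (hu.mul hf)) h).sub
      (hasValueAt_neg_one_pow x u e))

/-! ### Poles and size of `x^a|w` -/

/-- A bound for the absolute values of `J(±y, 0)` and `J(±y, 1)`. -/
def jBound (u y : ℂ) : ℝ :=
  ‖y‖ / 2 * (‖u - y‖ / ‖1 - u * y‖ + ‖u + y‖ / ‖1 + u * y‖ + 1)

theorem jBound_nonneg (u y : ℂ) : 0 ≤ jBound u y := by
  rw [jBound]
  positivity

theorem jBound_neg (u y : ℂ) : jBound u (-y) = jBound u y := by
  simp only [jBound, norm_neg, sub_neg_eq_add, mul_neg, ← sub_eq_add_neg]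
  ring

theorem norm_J_le (u y : ℂ) (e : ℕ) :
    ‖y / 2 * ((u - y) / (1 - u * y) - (-1) ^ e)‖ ≤ jBound u y := by
  rw [norm_mul, norm_div, Complex.norm_ofNat, jBound]
  refine mul_le_mul_of_nonneg_left ((norm_sub_le _ _).trans ?_) (by positivity)
  rw [norm_div, norm_pow, norm_neg, norm_one, one_pow]
  have : 0 ≤ ‖u + y‖ / ‖1 + u * y‖ := by positivity
  linarith

theorem monoVal_signPoint_eq_or (i : I) (x : I → ℂˣ) (a : I → ℤ) :
    (monoVal (signPoint Γ i x) a : ℂ) = monoVal x a ∨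
      (monoVal (signPoint Γ i x) a : ℂ) = -monoVal x a := by
  rw [monoVal_signPoint]
  rcases Int.even_or_odd (nbrSum Γ i a) with h | h
  · left; simp [h.neg_one_zpow]
  · right; simp [h.neg_one_zpow]

/-- Each `w` has a set of `ℓ(w)` positive real roots which controls the poles and the size
of `x^a|w`. -/
theorem exists_inversionSet (w : WeylGroup Γ) : ∃ N : Finset (I → ℤ),
    N.card = (coxSys Γ).length w ∧
    (∀ b ∈ N, IsPosRealRoot Γ b ∧ latticeHom Γ w b ≤ 0) ∧
    ∀ (x : I → ℂˣ) (u : ℂ), (∀ b ∈ N, u * monoVal x b ≠ 1 ∧ u * monoVal x b ≠ -1) →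
      ∀ a : I → ℤ, ∃ z, HasValueAt (slash Γ (mono a) w) x u z ∧
        ‖z‖ ≤ (∏ b ∈ N, 2 * jBound u (monoVal x b)) * ‖(monoVal x (latticeHom Γ w⁻¹ a) : ℂ)‖ := by
  induction hn : (coxSys Γ).length w using Nat.strong_induction_on generalizing w with
  | _ n ih =>
    subst hn
    by_cases hw : w = 1
    · subst hw
      refine ⟨∅, by simp, by simp, fun x u _ a => ⟨monoVal x a, ?_, ?_⟩⟩
      · rw [slash_one]
        exact hasValueAt_mono x u a
      · rw [inv_one, latticeHom_one, Finset.prod_empty, one_mul]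
    obtain ⟨i, hi⟩ := (coxSys Γ).exists_rightDescent_of_ne_one hw
    obtain ⟨v, rfl⟩ : ∃ v, w = v * sigma Γ i :=
      ⟨w * sigma Γ i, by rw [mul_assoc, sigma_mul_self, mul_one]⟩
    have hvi : ¬ (coxSys Γ).IsRightDescent v i := by
      have := ((coxSys Γ).isRightDescent_iff_not_isRightDescent_mul).mp hi
      rwa [CoxeterMatrix.toCoxeterSystem_simple, mul_assoc, sigma_mul_self, mul_one] at this
    have hlv : (coxSys Γ).length (v * sigma Γ i) = (coxSys Γ).length v + 1 :=
      ((coxSys Γ).not_isRightDescent_iff).mp hvi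
    obtain ⟨N, hcard, hN, hval⟩ := ih _ (by omega) v rfl
    have hne : ∀ b ∈ N, b ≠ Pi.single i 1 := by
      rintro b hb rfl
      refine (isRealRoot_latticeHom Γ v (hN _ hb).1.1).ne_zero Γ ?_
      exact le_antisymm (hN _ hb).2 (latticeHom_single_nonneg Γ v i hvi)
    have hinj : Function.Injective (reflect Γ i) := (reflectEquiv Γ i).injective
    have hnot : (Pi.single i 1 : I → ℤ) ∉ N.image (reflect Γ i) := by
      intro h
      obtain ⟨b, hb, h⟩ := Finset.mem_image.mp h
      have h2 := congrFun (congrArg (reflect Γ i) h) i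
      rw [reflect_reflect, reflect_single_self] at h2
      have := (hN b hb).1.2 i
      rw [h2] at this
      simp at this
    -- The usual recursion for inversion sets, `N(vσ_i) = {α_i} ∪ σ_i N(v)`. The union is disjoint
    -- because `σ_i α_i` is negative.
    refine ⟨insert (Pi.single i 1) (N.image (reflect Γ i)), ?_, ?_, ?_⟩
    · rw [Finset.card_insert_of_notMem hnot, Finset.card_image_of_injective _ hinj, hcard, hlv]
    · intro b hb
      rcases Finset.mem_insert.mp hb with rfl | hb
      · refine ⟨⟨.simple i, fun j => ?_⟩, latticeHom_single_nonpos Γ _ i hi⟩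
        exact (Pi.single_nonneg.mpr zero_le_one : (0 : I → ℤ) ≤ Pi.single i 1) j
      · obtain ⟨c, hc, rfl⟩ := Finset.mem_image.mp hb
        refine ⟨(hN c hc).1.reflect Γ i (hne c hc), ?_⟩
        rw [latticeHom_mul, latticeHom_sigma, reflect_reflect]
        exact (hN c hc).2
    · intro x u hx a
      have h1 := hx _ (Finset.mem_insert_self _ _)
      rw [monoVal_single, zpow_one] at h1
      have h2 : ∀ b ∈ N, u * monoVal x (reflect Γ i b) ≠ 1 ∧ u * monoVal x (reflect Γ i b) ≠ -1 :=
        fun b hb => hx _ (Finset.mem_insert_of_mem (Finset.mem_image_of_mem _ hb))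
      obtain ⟨z₁, hz₁, hn₁⟩ := hval (reflPoint Γ i x) u
        (fun b hb => by rw [monoVal_reflPoint]; exact h2 b hb) a
      -- `ε_i` changes `x^b` at most by a sign, and the excluded values `±1` of `u x^b` are
      -- symmetric; hence the sign-changed point is admissible too.
      obtain ⟨z₂, hz₂, hn₂⟩ := hval (signPoint Γ i (reflPoint Γ i x)) u
        (fun b hb => by
          have h3 := h2 b hb
          rcases monoVal_signPoint_eq_or Γ i (reflPoint Γ i x) b with e | e <;>
          rw [e, monoVal_reflPoint]
          · exact h3
          · refine ⟨fun h => h3.2 ?_, fun h => h3.1 ?_⟩ <;> linear_combination -h) a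
      have hd : (1 : ℂ) - u * x i ≠ 0 := fun h => h1.1 (sub_eq_zero.mp h).symm
      have hxi : HasValueAt (xvar i) x u (x i) := by
        simpa [monoVal_single] using hasValueAt_mono x u (Pi.single i 1)
      have e₁ : ∀ b, jBound u (monoVal (signPoint Γ i (reflPoint Γ i x)) b) =
          jBound u (monoVal x (reflect Γ i b)) := fun b => by
        rcases monoVal_signPoint_eq_or Γ i (reflPoint Γ i x) b with e | e <;>
        simp only [e, monoVal_reflPoint, jBound_neg]
      have e₂ : ∀ b, ‖(monoVal (signPoint Γ i (reflPoint Γ i x)) b : ℂ)‖ =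
          ‖(monoVal x (reflect Γ i b) : ℂ)‖ := fun b => by
        rcases monoVal_signPoint_eq_or Γ i (reflPoint Γ i x) b with e | e <;>
        simp only [e, monoVal_reflPoint, norm_neg]
      simp only [e₁, e₂] at hn₂
      simp only [monoVal_reflPoint] at hn₁
      have hv := ((hz₁.refl Γ).mul (hxi.J hd 0)).add ((((hz₂.sgn Γ).refl Γ)).mul (hxi.J hd 1))
      rw [← slash_simple, ← slash_mul] at hv
      refine ⟨_, hv, ?_⟩
      rw [Finset.prod_insert hnot, Finset.prod_image fun _ _ _ _ h => hinj h, mul_inv_rev,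
        sigma_inv, latticeHom_mul, latticeHom_sigma, monoVal_single, zpow_one]
      have hP : 0 ≤ (∏ b ∈ N, 2 * jBound u (monoVal x (reflect Γ i b))) *
          ‖(monoVal x (reflect Γ i (latticeHom Γ v⁻¹ a)) : ℂ)‖ :=
        mul_nonneg (Finset.prod_nonneg fun b _ => mul_nonneg zero_le_two (jBound_nonneg _ _))
          (norm_nonneg _)
      -- Each of the two summands of the action is bounded by `jBound`; their sum accounts for the
      -- factor `2` per root.
      refine (norm_add_le _ _).trans ?_
      rw [norm_mul z₁, norm_mul z₂]
      refine (add_le_add (mul_le_mul hn₁ (norm_J_le u _ 0) (norm_nonneg _) hP)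
        (mul_le_mul hn₂ (norm_J_le u _ 1) (norm_nonneg _) hP)).trans_eq ?_
      ring

end General

section General

variable {I : Type*} [Fintype I] [DecidableEq I] (Γ : SimpleGraph I) [DecidableRel Γ.Adj]

/-! ### Length series and the average at points close to the origin -/

/-- There are `|I|^n` words of length `n`, so the sum is a geometric series of ratio `|I| r`. -/
theorem hasSum_pow_length {r : ℝ} (hr : 0 ≤ r) (h : Fintype.card I * r < 1) :
    HasSum (fun l : List I => r ^ l.length) (1 - Fintype.card I * r)⁻¹ := by
  rw [← (List.equivSigmaTuple (α := I)).symm.hasSum_iff]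
  have hin : ∀ n, HasSum (fun l : Fin n → I => r ^ n) ((Fintype.card I * r) ^ n) := fun n => by
    have := hasSum_fintype fun _ : Fin n → I => r ^ n
    simpa [mul_pow] using this
  have hgeo := hasSum_geometric_of_lt_one (r := Fintype.card I * r) (by positivity) h
  have e : ((fun l : List I => r ^ l.length) ∘ (List.equivSigmaTuple (α := I)).symm) =
      fun s : Σ n, Fin n → I => r ^ s.1 := by
    ext s
    simp [List.equivSigmaTuple]
  rw [e]
  have hs : Summable fun s : Σ n, Fin n → I => r ^ s.1 := by
    refine (summable_sigma_of_nonneg fun s => pow_nonneg hr _).mpr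
      ⟨fun n => (hin n).summable, ?_⟩
    exact hgeo.summable.congr fun n => (hin n).tsum_eq.symm
  rw [← hgeo.tsum_eq, ← tsum_congr fun n => (hin n).tsum_eq, ← hs.tsum_sigma]
  exact hs.hasSum

/-- A reduced word of `w`. -/
def reducedWord (w : WeylGroup Γ) : List I := ((coxSys Γ).exists_isReduced w).choose

theorem wordProd_reducedWord (w : WeylGroup Γ) :
    (coxSys Γ).wordProd (reducedWord Γ w) = w :=
  ((coxSys Γ).exists_isReduced w).choose_spec.2.symm

theorem length_reducedWord (w : WeylGroup Γ) :
    (reducedWord Γ w).length = (coxSys Γ).length w := by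
  have h := ((coxSys Γ).exists_isReduced w).choose_spec.1.eq
  rw [← reducedWord, wordProd_reducedWord] at h
  exact h.symm

/-- Choosing a reduced word embeds `W` into the set of all words and preserves length, so the series
over words dominates. -/
theorem summable_pow_length {r : ℝ} (hr : 0 ≤ r) (h : Fintype.card I * r < 1) :
    Summable (fun w : WeylGroup Γ => r ^ (coxSys Γ).length w) ∧
      ∑' w : WeylGroup Γ, r ^ (coxSys Γ).length w ≤ (1 - Fintype.card I * r)⁻¹ := by
  have hinj : Function.Injective (reducedWord Γ) :=
    Function.LeftInverse.injective (wordProd_reducedWord Γ)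
  have hs := hasSum_pow_length hr h
  have e : (fun w : WeylGroup Γ => r ^ (coxSys Γ).length w) =
      (fun l : List I => r ^ l.length) ∘ reducedWord Γ := by
    ext w
    simp [length_reducedWord]
  rw [e, ← hs.tsum_eq]
  exact ⟨hs.summable.comp_injective hinj,
    tsum_comp_le_tsum_of_inj hs.summable (fun l => by positivity) hinj⟩

/-- The numerators are at most `1` and the denominators at least `3/4`, so the bound is at most `‖y‖
(4/3 + 4/3 + 1) / 2`. -/
theorem jBound_le {u y : ℂ} (hu : ‖u‖ ≤ 1 / 2) (hy : ‖y‖ ≤ 1 / 2) : jBound u y ≤ 2 * ‖y‖ := by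
  have h1 : ‖u * y‖ ≤ 1 / 4 := by
    rw [norm_mul]
    nlinarith [norm_nonneg u, norm_nonneg y]
  have h2 : 3 / 4 ≤ ‖1 - u * y‖ := by
    have := norm_sub_norm_le 1 (u * y)
    rw [norm_one] at this
    linarith
  have h3 : 3 / 4 ≤ ‖1 + u * y‖ := by
    have := norm_sub_norm_le 1 (-(u * y))
    rw [norm_one, norm_neg, sub_neg_eq_add] at this
    linarith
  have h4 : ‖u - y‖ / ‖1 - u * y‖ ≤ 4 / 3 := by
    rw [div_le_iff₀ (by linarith)]
    linarith [norm_sub_le u y]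
  have h5 : ‖u + y‖ / ‖1 + u * y‖ ≤ 4 / 3 := by
    rw [div_le_iff₀ (by linarith)]
    linarith [norm_add_le u y]
  rw [jBound]
  nlinarith [norm_nonneg y]

theorem monoVal_const (y : ℂˣ) (a : I → ℤ) : monoVal (fun _ => y) a = y ^ ∑ i, a i := by
  rw [monoVal]
  generalize Finset.univ (α := I) = s
  induction s using Finset.induction_on with
  | empty => simp
  | insert j s hj ih => rw [Finset.prod_insert hj, Finset.sum_insert hj, zpow_add, ih]

/-- At a diagonal point, `x^b` is `y` to the height of `b`, and a positive root has height at least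
`1`. -/
theorem norm_monoVal_const_le {y : ℂˣ} (hy : ‖(y : ℂ)‖ ≤ 1 / 2) {b : I → ℤ}
    (hb : IsPosRealRoot Γ b) : ‖(monoVal (fun _ => y) b : ℂ)‖ ≤ ‖(y : ℂ)‖ := by
  have h0 : ∑ i, b i ≠ 0 := fun h => hb.1.ne_zero Γ <| by
    ext i
    exact (Finset.sum_eq_zero_iff_of_nonneg fun i _ => hb.2 i).mp h i (Finset.mem_univ i)
  have h1 : 0 ≤ ∑ i, b i := Finset.sum_nonneg fun i _ => hb.2 i
  obtain ⟨n, hn⟩ := Int.eq_ofNat_of_zero_le h1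
  rw [monoVal_const, hn, zpow_natCast, Units.val_pow_eq_pow_val, norm_pow]
  exact pow_le_of_le_one (norm_nonneg _) (by linarith) (by omega)

theorem norm_mul_monoVal_const_lt {y : ℂˣ} (hy : ‖(y : ℂ)‖ ≤ 1 / 2) {u : ℂ} (hu : ‖u‖ ≤ 1 / 2)
    {b : I → ℤ} (hb : IsPosRealRoot Γ b) : ‖u * monoVal (fun _ => y) b‖ < 1 := by
  have := norm_monoVal_const_le Γ hy hb
  rw [norm_mul]
  nlinarith [norm_nonneg u, norm_nonneg (monoVal (fun _ => y) b : ℂ)]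

theorem exists_hasValueAt_const {y : ℂˣ} (hy : ‖(y : ℂ)‖ ≤ 1 / 2) {u : ℂ} (hu : ‖u‖ ≤ 1 / 2)
    (w : WeylGroup Γ) : ∃ z, HasValueAt (slash Γ 1 w) (fun _ => y) u z ∧
      ‖z‖ ≤ (4 * ‖(y : ℂ)‖) ^ (coxSys Γ).length w := by
  obtain ⟨N, hcard, hN, hval⟩ := exists_inversionSet Γ w
  obtain ⟨z, hz, hle⟩ := hval (fun _ => y) u (fun b hb => by
    have := norm_mul_monoVal_const_lt Γ hy hu (hN b hb).1
    constructor <;> intro h <;> rw [h] at this <;> simp at this) 0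
  rw [mono_zero] at hz
  refine ⟨z, hz, hle.trans ?_⟩
  rw [map_zero, monoVal_zero, Units.val_one, norm_one, mul_one, ← hcard, ← Finset.prod_const]
  refine Finset.prod_le_prod (fun b _ => mul_nonneg zero_le_two (jBound_nonneg _ _)) fun b hb => ?_
  have h1 := norm_monoVal_const_le Γ hy (hN b hb).1
  linarith [jBound_le hu (h1.trans hy)]

/-- The term `w = 1` equals `1`. The length series is at most `3/2`, so the remaining terms sum to
at most `1/2` in absolute value and cannot cancel it. -/
theorem tsum_value_const_ne_zero {y : ℂˣ} (hy : ‖(y : ℂ)‖ ≤ 1 / 2)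
    (hy' : Fintype.card I * (4 * ‖(y : ℂ)‖) ≤ 1 / 3) {u : ℂ} (hu : ‖u‖ ≤ 1 / 2) :
    ∑' w : WeylGroup Γ, value (slash Γ 1 w) (fun _ => y) u ≠ 0 := by
  classical
  have hle : ∀ w : WeylGroup Γ, ‖value (slash Γ 1 w) (fun _ => y) u‖ ≤
      (4 * ‖(y : ℂ)‖) ^ (coxSys Γ).length w := fun w => by
    obtain ⟨z, hz, h⟩ := exists_hasValueAt_const Γ hy hu w
    rwa [hz.value_eq]
  obtain ⟨hs, ht⟩ := summable_pow_length Γ (r := 4 * ‖(y : ℂ)‖) (by positivity) (by linarith)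
  have hone : value (slash Γ 1 (1 : WeylGroup Γ)) (fun _ => y) u = 1 := by
    rw [slash_one]
    exact (hasValueAt_one _ _).value_eq
  have hsum := Summable.of_norm_bounded hs hle
  have h3 : (1 - Fintype.card I * (4 * ‖(y : ℂ)‖))⁻¹ ≤ 3 / 2 := by
    rw [inv_le_comm₀ (by linarith) (by norm_num)]
    linarith
  rw [hsum.tsum_eq_add_tsum_ite 1, hone]
  rw [hs.tsum_eq_add_tsum_ite 1, CoxeterSystem.length_one, pow_zero] at ht
  intro h
  have hs' : Summable fun w : WeylGroup Γ =>
      if w = 1 then 0 else (4 * ‖(y : ℂ)‖) ^ (coxSys Γ).length w := by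
    refine hs.of_nonneg_of_le (fun w => ?_) (fun w => ?_) <;> split_ifs <;>
      first | exact le_rfl | positivity
  have hb : ‖∑' w : WeylGroup Γ, if w = 1 then 0 else value (slash Γ 1 w) (fun _ => y) u‖ ≤
      ∑' w : WeylGroup Γ, if w = 1 then 0 else (4 * ‖(y : ℂ)‖) ^ (coxSys Γ).length w := by
    refine tsum_of_norm_bounded hs'.hasSum fun w => ?_
    split_ifs
    · simp
    · exact hle w
  rw [eq_neg_of_add_eq_zero_right h, norm_neg, norm_one] at hb
  linarith

end General

/-! ### Type `D₄⁽¹⁾` -/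

theorem nbrSum_affineD4 (i : Fin 5) (a : Fin 5 → ℤ) :
    nbrSum affineD4 i a = if i = 4 then a 0 + a 1 + a 2 + a 3 else a 4 := by
  have h0 : affineD4.neighborFinset 0 = {4} := by decide
  have h1 : affineD4.neighborFinset 1 = {4} := by decide
  have h2 : affineD4.neighborFinset 2 = {4} := by decide
  have h3 : affineD4.neighborFinset 3 = {4} := by decide
  have h4 : affineD4.neighborFinset 4 = {0, 1, 2, 3} := by decide
  fin_cases i
  · simp [nbrSum, h0]
  · simp [nbrSum, h1]
  · simp [nbrSum, h2]
  · simp [nbrSum, h3]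
  · simp [nbrSum, h4, add_assoc]

/-- The invariant quadratic form (twice the usual one). -/
def quadForm (b : Fin 5 → ℤ) : ℤ :=
  (b 0 - b 1) ^ 2 + (b 4 - b 0 - b 1) ^ 2 + (b 2 + b 3 - b 4) ^ 2 + (b 2 - b 3) ^ 2

theorem quadForm_reflect (i : Fin 5) (b : Fin 5 → ℤ) :
    quadForm (reflect affineD4 i b) = quadForm b := by
  fin_cases i <;>
  · simp [quadForm, reflect, nbrSum_affineD4]
    ring

theorem quadForm_nonneg (b : Fin 5 → ℤ) : 0 ≤ quadForm b := by
  rw [quadForm]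
  positivity

/-- Up to sign, `v_i(b) - 2 b_i` is a sum or difference of two of the four numbers squared in the
form, and `n ≤ n²` for integers. This bounds how far one reflection can move any point of an orbit.
-/
theorem abs_nbrSum_sub_le (i : Fin 5) (b : Fin 5 → ℤ) :
    |nbrSum affineD4 i b - 2 * b i| ≤ quadForm b := by
  have key : ∀ p q r s : ℤ, |p + q| ≤ p ^ 2 + q ^ 2 + r ^ 2 + s ^ 2 := fun p q r s => by
    have h1 : ∀ n : ℤ, n ≤ n ^ 2 := fun n => Int.le_self_sq n
    rw [abs_le]
    have := h1 p; have := h1 q; have := h1 (-p); have := h1 (-q)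
    rw [neg_sq] at *
    constructor <;> nlinarith [sq_nonneg r, sq_nonneg s]
  fin_cases i
  · convert key (b 0 - b 1) (-(b 4 - b 0 - b 1)) (b 2 + b 3 - b 4) (b 2 - b 3) using 1
    · rw [← abs_neg]; congr 1; simp [nbrSum_affineD4]; ring
    · rw [quadForm]; ring
  · convert key (b 0 - b 1) (b 4 - b 0 - b 1) (b 2 + b 3 - b 4) (b 2 - b 3) using 1
    · congr 1; simp [nbrSum_affineD4]; ring
    · rw [quadForm]
  · convert key (b 2 + b 3 - b 4) (b 2 - b 3) (b 0 - b 1) (b 4 - b 0 - b 1) using 1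
    · rw [← abs_neg]; congr 1; simp [nbrSum_affineD4]; ring
    · rw [quadForm]; ring
  · convert key (b 2 + b 3 - b 4) (-(b 2 - b 3)) (b 0 - b 1) (b 4 - b 0 - b 1) using 1
    · rw [← abs_neg]; congr 1; simp [nbrSum_affineD4]; ring
    · rw [quadForm]; ring
  · convert key (b 2 + b 3 - b 4) (-(b 4 - b 0 - b 1)) (b 0 - b 1) (b 2 - b 3) using 1
    · congr 1; simp [nbrSum_affineD4]; ring
    · rw [quadForm]; ring

theorem quadForm_eq_two {b : Fin 5 → ℤ} (hb : IsRealRoot affineD4 b) : quadForm b = 2 := by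
  induction hb with
  | simple i => revert i; decide
  | reflect i b _ ih => rw [quadForm_reflect, ih]

theorem norm_zpow_le {t M : ℝ} (ht : 0 < t) (h1 : t ≤ M) (h2 : t⁻¹ ≤ M) (hM : 1 ≤ M) {m : ℤ}
    {n : ℕ} (hm : |m| ≤ n) : t ^ m ≤ M ^ n := by
  rcases le_total 0 m with h | h
  · lift m to ℕ using h
    rw [zpow_natCast]
    refine (pow_le_pow_left₀ ht.le h1 m).trans (pow_le_pow_right₀ hM ?_)
    simpa using hm
  · obtain ⟨k, rfl⟩ : ∃ k : ℕ, m = -k := ⟨m.natAbs, by omega⟩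
    rw [zpow_neg, zpow_natCast, ← inv_pow]
    refine (pow_le_pow_left₀ (inv_pos.mpr ht).le h2 k).trans (pow_le_pow_right₀ hM ?_)
    simpa using hm

/-- `x^(w a)` grows at most exponentially in the length of `w`. -/
theorem exists_norm_monoVal_latticeHom_le (x : Fin 5 → ℂˣ) (a : Fin 5 → ℤ) :
    ∃ D : ℝ, 1 ≤ D ∧ ∀ w : WeylGroup affineD4, ‖(monoVal x (latticeHom affineD4 w a) : ℂ)‖ ≤
      ‖(monoVal x a : ℂ)‖ * D ^ (coxSys affineD4).length w := by
  -- `M` dominates all `‖x_i‖` and `‖x_i‖⁻¹`. A reflection multiplies `x^b` by a power of `x_i` with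
  -- exponent at most `quadForm b` in absolute value, and this number is constant on the orbit;
  -- hence `D = M ^ quadForm a`.
  set M : ℝ := 1 + ∑ i, (‖(x i : ℂ)‖ + ‖(x i : ℂ)‖⁻¹)
  have hx : ∀ i, 0 < ‖(x i : ℂ)‖ := fun i => norm_pos_iff.mpr (x i).ne_zero
  have hsum : ∀ i, ‖(x i : ℂ)‖ + ‖(x i : ℂ)‖⁻¹ ≤ ∑ i, (‖(x i : ℂ)‖ + ‖(x i : ℂ)‖⁻¹) := fun i =>
    Finset.single_le_sum (f := fun i => ‖(x i : ℂ)‖ + ‖(x i : ℂ)‖⁻¹)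
      (fun i _ => by have := hx i; positivity) (Finset.mem_univ i)
  have hM : 1 ≤ M := le_add_of_nonneg_right (Finset.sum_nonneg fun i _ => by
    have := hx i; positivity)
  have hxM : ∀ i, ‖(x i : ℂ)‖ ≤ M ∧ ‖(x i : ℂ)‖⁻¹ ≤ M := fun i => by
    have := hsum i
    have := inv_pos.mpr (hx i)
    have := hx i
    constructor <;> linarith
  refine ⟨M ^ (quadForm a).toNat, one_le_pow₀ hM, fun w => ?_⟩
  suffices h : ∀ ω : List (Fin 5), quadForm (latticeHom affineD4 ((coxSys affineD4).wordProd ω) a) =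
      quadForm a ∧ ‖(monoVal x (latticeHom affineD4 ((coxSys affineD4).wordProd ω) a) : ℂ)‖ ≤
      ‖(monoVal x a : ℂ)‖ * (M ^ (quadForm a).toNat) ^ ω.length by
    have := (h (reducedWord affineD4 w)).2
    rwa [wordProd_reducedWord, length_reducedWord] at this
  intro ω
  induction ω with
  | nil => simp
  | cons i ω ih =>
    obtain ⟨hq, hle⟩ := ih
    rw [CoxeterSystem.wordProd_cons, latticeHom_mul, CoxeterMatrix.toCoxeterSystem_simple,
      latticeHom_sigma, quadForm_reflect]
    refine ⟨hq, ?_⟩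
    rw [reflect, monoVal_add, monoVal_single, Units.val_mul, norm_mul, Units.val_zpow_eq_zpow_val,
      norm_zpow, List.length_cons, pow_succ, ← mul_assoc]
    refine mul_le_mul hle (norm_zpow_le (hx i) (hxM i).1 (hxM i).2 hM ?_)
      (zpow_nonneg (norm_nonneg _) _) (by positivity)
    rw [Int.toNat_of_nonneg (quadForm_nonneg a), ← hq]
    exact abs_nbrSum_sub_le i _

/-- Only finitely many positive real roots `b` have `‖x^b‖ ≥ η`. -/
theorem finite_le_norm_monoVal {x : Fin 5 → ℂˣ} (hx : ‖(monoVal x delta : ℂ)‖ < 1) {η : ℝ}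
    (hη : 0 < η) : {b | IsPosRealRoot affineD4 b ∧ η ≤ ‖(monoVal x b : ℂ)‖}.Finite := by
  have hfin : ∀ c : Fin 5 → ℤ, {n : ℕ | ¬ ‖(monoVal x delta : ℂ)‖ ^ n * ‖(monoVal x c : ℂ)‖ < η
      }.Finite := fun c => by
    have h := (tendsto_pow_atTop_nhds_zero_of_lt_one (norm_nonneg _) hx).mul_const
      ‖(monoVal x c : ℂ)‖
    rw [zero_mul] at h
    have h' := h.eventually_lt_const hη
    rw [← Nat.cofinite_eq_atTop, Filter.eventually_cofinite] at h'
    exact h'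
  -- A real root has `quadForm b = 2`, so its four differences lie in `{-1, 0, 1}`. After
  -- subtracting `b_0 δ` the coordinate `0` vanishes, and the others are confined to a fixed box.
  -- Thus the roots lie in finitely many rays `c + ℕδ`, and on each ray `‖x^b‖` tends to `0`.
  have hS := (Fintype.piFinset fun _ : Fin 5 => Finset.Icc (-4 : ℤ) 4).finite_toSet
  refine (hS.biUnion fun c _ => (hfin c).image fun n : ℕ => (n : ℤ) • delta + c).subset ?_
  rintro b ⟨hb, hle⟩
  simp only [Set.mem_iUnion]
  have hq := quadForm_eq_two hb.1
  obtain ⟨n, hn⟩ := Int.eq_ofNat_of_zero_le (hb.2 0)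
  have e : (n : ℤ) • delta + (b - (n : ℤ) • delta) = b := by abel
  have hsq : ∀ p : ℤ, p ^ 2 ≤ 2 → -1 ≤ p ∧ p ≤ 1 := fun p hp => by
    constructor <;> nlinarith
  simp only [quadForm] at hq
  have s1 := sq_nonneg (b 0 - b 1)
  have s2 := sq_nonneg (b 4 - b 0 - b 1)
  have s3 := sq_nonneg (b 2 + b 3 - b 4)
  have s4 := sq_nonneg (b 2 - b 3)
  obtain ⟨h1, h1'⟩ := hsq (b 0 - b 1) (by linarith)
  obtain ⟨h2, h2'⟩ := hsq (b 4 - b 0 - b 1) (by linarith)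
  obtain ⟨h3, h3'⟩ := hsq (b 2 + b 3 - b 4) (by linarith)
  obtain ⟨h4, h4'⟩ := hsq (b 2 - b 3) (by linarith)
  refine ⟨b - (n : ℤ) • delta, ?_, n, ?_, e⟩
  · rw [Finset.mem_coe, Fintype.mem_piFinset]
    intro i
    rw [Finset.mem_Icc]
    fin_cases i <;> simp [delta] <;> omega
  · rw [Set.mem_ofPred_eq, not_lt, ← norm_pow, ← norm_mul, ← Units.val_pow_eq_pow_val,
      ← zpow_natCast, ← monoVal_zsmul, ← Units.val_mul, ← monoVal_add, e]
    exact hle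

/-! ### Convergence on the region -/

theorem tendsto_jBound (u : ℂ) : Filter.Tendsto (jBound u) (nhds 0) (nhds 0) := by
  have : ContinuousAt (jBound u) 0 := by
    unfold jBound
    refine ContinuousAt.mul (by fun_prop) (.add (.add (.div (by fun_prop) (by fun_prop) ?_)
      (.div (by fun_prop) (by fun_prop) ?_)) (by fun_prop)) <;> simp
  have h := this.tendsto
  rwa [show jBound u 0 = 0 by simp [jBound]] at h

/-- Only finitely many factors exceed `ε`. Their excess over `ε` goes into the constant, uniformly
in `N`, since the factors over a set `N` are never repeated. -/
theorem exists_prod_le {α : Type*} [DecidableEq α] (P : α → Prop) (B : α → ℝ) (hB : ∀ b, 0 ≤ B b)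
    {ε : ℝ} (hε : 0 < ε) (hfin : {b | P b ∧ ε < B b}.Finite) :
    ∃ C, 0 ≤ C ∧ ∀ N : Finset α, (∀ b ∈ N, P b) → ∏ b ∈ N, B b ≤ C * ε ^ N.card := by
  set E := hfin.toFinset
  have hm : ∀ b, 1 ≤ max (B b / ε) 1 := fun b => le_max_right _ _
  refine ⟨∏ b ∈ E, max (B b / ε) 1, Finset.prod_nonneg fun b _ => zero_le_one.trans (hm b),
    fun N hN => ?_⟩
  calc ∏ b ∈ N, B b ≤ ∏ b ∈ N, (if b ∈ E then max (B b / ε) 1 else 1) * ε := by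
        refine Finset.prod_le_prod (fun b _ => hB b) fun b hb => ?_
        split_ifs with h
        · rw [← div_le_iff₀ hε]
          exact le_max_left _ _
        · rw [one_mul]
          by_contra h'
          exact h (hfin.mem_toFinset.mpr ⟨hN b hb, not_le.mp h'⟩)
    _ = (∏ b ∈ N ∩ E, max (B b / ε) 1) * ε ^ N.card := by
        rw [Finset.prod_mul_distrib, Finset.prod_const, Finset.prod_ite_mem]
    _ ≤ _ := by
        refine mul_le_mul_of_nonneg_right ?_ (by positivity)
        rw [← Finset.prod_sdiff (Finset.inter_subset_right (s₁ := N) (s₂ := E))]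
        refine le_mul_of_one_le_left (Finset.prod_nonneg fun b _ => zero_le_one.trans (hm b)) ?_
        exact Finset.one_le_prod fun b _ => hm b

/-- On the region, every `x^a|w` is regular, and the series of their values converges. -/
theorem isRegularAt_and_summable {x : Fin 5 → ℂˣ} {u : ℂ} (h : InRegion x u) (a : Fin 5 → ℤ) :
    (∀ w : WeylGroup affineD4, IsRegularAt (slash affineD4 (mono a) w) x u) ∧
      Summable fun w : WeylGroup affineD4 => value (slash affineD4 (mono a) w) x u := by
  choose N hcard hN hval using exists_inversionSet affineD4
  choose z hz hle using fun w => hval w x u (fun b hb => h.2 b (hN w b hb).1) a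
  refine ⟨fun w => ⟨_, hz w⟩, ?_⟩
  simp only [fun w => (hz w).value_eq]
  obtain ⟨D, hD, hgrow⟩ := exists_norm_monoVal_latticeHom_le x a
  -- With this `ε`, decay `ε` per root and growth `D` per letter combine to `1/10`, and `5 · 1/10 <
  -- 1` makes the length series converge.
  set ε : ℝ := (10 * D)⁻¹
  have hε : 0 < ε := by positivity
  have hεD : ε * D = 1 / 10 := by
    simp only [ε]
    field_simp
  obtain ⟨η, hη, hsmall⟩ := Metric.eventually_nhds_iff.mp
    ((tendsto_jBound u).eventually_le_const (half_pos hε))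
  obtain ⟨C, hC, hprod⟩ := exists_prod_le (IsPosRealRoot affineD4)
    (fun b => 2 * jBound u (monoVal x b)) (fun b => mul_nonneg zero_le_two (jBound_nonneg _ _)) hε
    ((finite_le_norm_monoVal h.1 hη).subset fun b hb => ⟨hb.1, by
      by_contra h'
      have := hsmall (y := (monoVal x b : ℂ)) (by rw [dist_zero_right]; exact not_le.mp h')
      have h2 : ε < 2 * jBound u (monoVal x b) := hb.2
      linarith⟩)
  have hs := (summable_pow_length affineD4 (r := 1 / 10) (by norm_num) (by norm_num)).1
  refine Summable.of_norm_bounded (hs.mul_left (C * ‖(monoVal x a : ℂ)‖)) fun w => ?_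
  refine (hle w).trans ?_
  have h1 := hprod (N w) fun b hb => (hN w b hb).1
  have h2 := hgrow w⁻¹
  rw [CoxeterSystem.length_inv] at h2
  refine (mul_le_mul h1 h2 (norm_nonneg _) (by positivity)).trans_eq ?_
  rw [hcard, ← hεD, mul_pow]
  ring

/-! ### The order on monomials -/

theorem lex_map {α β : Type*} [LT α] [LT β] (f : α → β) {l l' : List α}
    (h : List.Lex (· < ·) l l') (hf : ∀ p ∈ l, ∀ q ∈ l', p < q → f p < f q) :
    List.Lex (· < ·) (l.map f) (l'.map f) := by
  induction h with
  | nil => exact .nil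
  | rel h => exact .rel (hf _ (by simp) _ (by simp) h)
  | cons _ ih =>
    exact .cons (ih fun p hp q hq => hf p (List.mem_cons_of_mem _ hp) q (List.mem_cons_of_mem _ hq))

/-- Decreasing lists are compared by the multiplicities of their largest entries. -/
theorem lt_of_count_lt {l' l : List ℤ} (hl' : l'.Pairwise (· ≥ ·)) (hl : l.Pairwise (· ≥ ·))
    {M : ℤ} (heq : ∀ t, M < t → l'.count t = l.count t) (hlt : l'.count M < l.count M) :
    l' < l := by
  induction l' generalizing l with
  | nil =>
    cases l with
    | nil => simp at hlt
    | cons c l => exact .nil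
  | cons b l' ih =>
    cases l with
    | nil => simp at hlt
    | cons c l =>
      rw [List.pairwise_cons] at hl hl'
      have hc : ∀ t, t ∈ c :: l → t ≤ c := fun t ht => by
        rcases List.mem_cons.mp ht with rfl | ht
        · exact le_rfl
        · exact hl.1 t ht
      have hM : M ≤ c := hc M (List.count_pos_iff.mp (by omega))
      rw [List.cons_lt_cons_iff]
      rcases lt_trichotomy b c with h | rfl | h
      · exact .inl h
      · refine .inr ⟨rfl, ih hl'.2 hl.2 (fun t ht => ?_) ?_⟩
        · have := heq t ht
          rw [List.count_cons, List.count_cons] at this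
          omega
        · rw [List.count_cons, List.count_cons] at hlt
          omega
      -- If `b > c ≥ M`, then `b` would have to occur in a list whose largest entry is `c`.
      · have h1 := heq b (hM.trans_lt h)
        have h2 : 0 < (c :: l).count b := by
          rw [← h1]
          exact List.count_pos_iff.mpr (by simp)
        exact absurd (hc b (List.count_pos_iff.mp h2)) (not_le.mpr h)

theorem pairwise_diffTuple (a : Fin 5 → ℤ) : (diffTuple a).Pairwise (· ≥ ·) :=
  List.pairwise_insertionSort _ _

theorem length_diffTuple (a : Fin 5 → ℤ) : (diffTuple a).length = 8 := by
  rw [diffTuple, List.length_insertionSort]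
  rfl

/-- The multiplicity of `t` among `p` and `-p`. -/
def signCount (p t : ℤ) : ℕ := [p, -p].count t

theorem count_diffTuple (a : Fin 5 → ℤ) (t : ℤ) : (diffTuple a).count t =
    signCount (a 0 - a 1) t + signCount (a 4 - a 0 - a 1) t + signCount (a 2 + a 3 - a 4) t +
      signCount (a 2 - a 3) t := by
  rw [diffTuple, (List.perm_insertionSort _ _).count_eq]
  simp only [signCount, List.count_cons, List.count_nil]
  ring

theorem neg_mem_diffTuple {a : Fin 5 → ℤ} {y : ℤ} (hy : y ∈ diffTuple a) : -y ∈ diffTuple a := by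
  rw [diffTuple, List.mem_insertionSort] at hy ⊢
  simp only [List.mem_cons, List.not_mem_nil, or_false] at hy ⊢
  omega

/-- Each tuple is symmetric under negation, so its entries are bounded below by minus its head.
Adding the head turns it into eight natural numbers. The shift respects the order: equal heads give
equal shifts, and a smaller head `m` gives a smaller first entry `2m`. On lists of equal length the
shortlex order is the lexicographic one, and it is well-founded. -/
theorem wellFounded_monoLT : WellFounded MonoLT := by
  let enc : (Fin 5 → ℤ) → List ℕ := fun a =>
    (diffTuple a).map fun n => (n + (diffTuple a).headI).toNat
  refine Subrelation.wf (r := InvImage (List.Shortlex (· < ·)) enc) (fun {a b} h => ?_)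
    (InvImage.wf enc (List.Shortlex.wf wellFounded_lt))
  have hlen : (enc a).length = (enc b).length := by simp [enc, length_diffTuple]
  refine List.Shortlex.of_lex hlen ?_
  have hbd : ∀ c : Fin 5 → ℤ, ∀ y ∈ diffTuple c, -(diffTuple c).headI ≤ y := fun c y hy => by
    have hn := neg_mem_diffTuple hy
    have hp := pairwise_diffTuple c
    generalize diffTuple c = l at hn hp
    cases l with
    | nil => simp at hn
    | cons m l =>
      rw [List.pairwise_cons] at hp
      rcases List.mem_cons.mp hn with h | h
      · simp only [List.headI_cons]; omega
      · have := hp.1 _ h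
        simp only [List.headI_cons]; omega
  have hb := hbd b
  have ha := hbd a
  have hla := length_diffTuple a
  simp only [enc]
  unfold MonoLT at h
  generalize diffTuple a = l at *
  generalize diffTuple b = l' at *
  by_cases he : l.headI = l'.headI
  · rw [he]
    refine lex_map _ h fun p hp q hq hpq => ?_
    have := ha p hp
    have := hb q hq
    omega
  · cases h with
    | nil => simp at hla
    | cons h => simp at he
    | rel h =>
      have := ha _ (List.mem_cons_self ..)
      have := hb _ (List.mem_cons_self ..)
      simp only [List.map_cons, List.headI_cons] at *
      exact .rel (by omega)

theorem signCount_eq_zero {p t : ℤ} (h : |p| < t) : signCount p t = 0 := by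
  rw [abs_lt] at h
  rw [signCount, List.count_eq_zero]
  simp only [List.mem_cons, List.not_mem_nil, or_false]
  omega

theorem signCount_abs_pos (p : ℤ) : 0 < signCount p |p| := by
  rw [signCount, List.count_pos_iff]
  rcases abs_choice p with h | h <;> simp [h]

/-- The new pair lies strictly inside the range of the old one, so nothing changes above the old
maximum while the multiplicity of that maximum drops. -/
theorem signCount_add_lt {p q p' q' : ℤ} (h : max |p'| |q'| < max |p| |q|) :
    (∀ t, max |p| |q| < t →
      signCount p' t + signCount q' t = signCount p t + signCount q t) ∧
    signCount p' (max |p| |q|) + signCount q' (max |p| |q|) <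
      signCount p (max |p| |q|) + signCount q (max |p| |q|) := by
  refine ⟨fun t ht => ?_, ?_⟩
  · have h' := h.trans ht
    rw [max_lt_iff] at ht h'
    rw [signCount_eq_zero ht.1, signCount_eq_zero ht.2, signCount_eq_zero h'.1,
      signCount_eq_zero h'.2]
  · have h' := max_lt_iff.mp h
    rw [signCount_eq_zero h'.1, signCount_eq_zero h'.2]
    rcases max_choice |p| |q| with e | e <;> rw [e]
    · have := signCount_abs_pos p
      omega
    · have := signCount_abs_pos q
      omega

/-- Subtracting `k α_i` changes only two of the four differences. After suitable signs they are `p`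
and `q` with `p - q = 2 a_i - v_i(a)`, and they become `p - k` and `q + k`. For `k` strictly between
`0` and `p - q`, both new numbers lie strictly between `q` and `p`, so the larger absolute value
drops. -/
theorem monoLT_sub_single {a : Fin 5 → ℤ} {i : Fin 5} {k : ℤ} (hk : 0 < k)
    (hk' : k < 2 * a i - nbrSum affineD4 i a) : MonoLT (a - Pi.single i k) a := by
  have key : ∀ p q p' q' r s : ℤ,
      (∀ t, (diffTuple a).count t = signCount p t + signCount q t + signCount r t +
        signCount s t) →
      (∀ t, (diffTuple (a - Pi.single i k)).count t = signCount p' t + signCount q' t +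
        signCount r t + signCount s t) → max |p'| |q'| < max |p| |q| →
      MonoLT (a - Pi.single i k) a := by
    intro p q p' q' r s h1 h2 h
    obtain ⟨h3, h4⟩ := signCount_add_lt h
    refine lt_of_count_lt (pairwise_diffTuple _) (pairwise_diffTuple _)
      (M := max |p| |q|) (fun t ht => ?_) ?_
    · rw [h1, h2, h3 t ht]
    · rw [h1, h2]
      omega
  rw [nbrSum_affineD4] at hk'
  fin_cases i <;> simp at hk'
  · refine key (a 0 - a 1) (a 4 - a 0 - a 1) (a 0 - k - a 1) (a 4 - (a 0 - k) - a 1)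
      (a 2 + a 3 - a 4) (a 2 - a 3) (fun t => ?_) (fun t => ?_) ?_
    · rw [count_diffTuple]
    · rw [count_diffTuple]; simp
    · simp only [max_lt_iff, lt_max_iff, abs_lt, lt_abs]
      omega
  · refine key (a 0 - a 1) (a 4 - a 0 - a 1) (a 0 - (a 1 - k)) (a 4 - a 0 - (a 1 - k))
      (a 2 + a 3 - a 4) (a 2 - a 3) (fun t => ?_) (fun t => ?_) ?_
    · rw [count_diffTuple]
    · rw [count_diffTuple]; simp
    · simp only [max_lt_iff, lt_max_iff, abs_lt, lt_abs]
      omega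
  · refine key (a 2 + a 3 - a 4) (a 2 - a 3) (a 2 - k + a 3 - a 4) (a 2 - k - a 3)
      (a 0 - a 1) (a 4 - a 0 - a 1) (fun t => ?_) (fun t => ?_) ?_
    · rw [count_diffTuple]; ring
    · rw [count_diffTuple]; simp; ring
    · simp only [max_lt_iff, lt_max_iff, abs_lt, lt_abs]
      omega
  · refine key (a 2 + a 3 - a 4) (a 2 - a 3) (a 2 + (a 3 - k) - a 4) (a 2 - (a 3 - k))
      (a 0 - a 1) (a 4 - a 0 - a 1) (fun t => ?_) (fun t => ?_) ?_
    · rw [count_diffTuple]; ring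
    · rw [count_diffTuple]; simp; ring
    · simp only [max_lt_iff, lt_max_iff, abs_lt, lt_abs]
      omega
  · refine key (a 4 - a 0 - a 1) (a 2 + a 3 - a 4) (a 4 - k - a 0 - a 1) (a 2 + a 3 - (a 4 - k))
      (a 0 - a 1) (a 2 - a 3) (fun t => ?_) (fun t => ?_) ?_
    · rw [count_diffTuple]; ring
    · rw [count_diffTuple]; simp; ring
    · simp only [max_lt_iff, lt_max_iff, abs_lt, lt_abs]
      omega

theorem reflect_add_single (i : Fin 5) (a : Fin 5 → ℤ) (k : ℤ) :
    reflect affineD4 i a + Pi.single i k =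
      a - Pi.single i (2 * a i - nbrSum affineD4 i a - k) := by
  rw [reflect, add_assoc, ← Pi.single_add, eq_sub_iff_add_eq, add_assoc, ← Pi.single_add,
    show nbrSum affineD4 i a - 2 * a i + k + (2 * a i - nbrSum affineD4 i a - k) = 0 by ring,
    Pi.single_zero, add_zero]

theorem two_smul_single (i : Fin 5) : 2 • (Pi.single i 1 : Fin 5 → ℤ) = Pi.single i 2 := by
  rw [← Pi.single_smul]
  rfl

theorem monoLT_of_mem_recursionStep {a : Fin 5 → ℤ} {i : Fin 5}
    (h : nbrSum affineD4 i a < 2 * a i) {t : ℤ[X] × (Fin 5 → ℤ)} (ht : t ∈ recursionStep i a) :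
    MonoLT t.2 a := by
  unfold recursionStep at ht
  simp only [two_smul_single] at ht
  split_ifs at ht with h1 h2 h2
  · simp at ht
  · rw [List.mem_singleton] at ht
    subst ht
    rw [Int.odd_iff] at h1
    rw [reflect_add_single]
    exact monoLT_sub_single (by omega) (by omega)
  · rw [List.mem_singleton] at ht
    subst ht
    exact monoLT_sub_single (by omega) (by omega)
  · rw [Int.not_odd_iff_even, Int.even_iff] at h1
    simp only [List.mem_cons, List.not_mem_nil, or_false] at ht
    rcases ht with rfl | rfl | rfl
    · rw [reflect_add_single]
      exact monoLT_sub_single (by omega) (by omega)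
    · exact monoLT_sub_single (by omega) (by omega)
    · rw [reflect_add_single]
      exact monoLT_sub_single (by omega) (by omega)

/-- If `2 a_i ≤ v_i(a)` at every vertex, the four leaf inequalities add up to the reverse of the
central one. All are therefore equalities, which gives a multiple of `δ`. -/
theorem exists_nbrSum_lt {a : Fin 5 → ℤ} (h : ¬ ∃ n : ℤ, a = n • delta) :
    ∃ i, nbrSum affineD4 i a < 2 * a i := by
  by_contra! h'
  have h0 := h' 0
  have h1 := h' 1
  have h2 := h' 2
  have h3 := h' 3
  have h4 := h' 4
  simp [nbrSum_affineD4] at h0 h1 h2 h3 h4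
  refine h ⟨a 0, ?_⟩
  ext i
  fin_cases i <;> simp [delta] <;> omega

theorem nbrSum_zsmul_delta (n : ℤ) (i : Fin 5) :
    nbrSum affineD4 i (n • delta) = 2 * (n • delta) i := by
  fin_cases i <;> simp [nbrSum_affineD4, delta] <;> ring

section General

variable {I : Type*} [Fintype I] [DecidableEq I] (Γ : SimpleGraph I) [DecidableRel Γ.Adj]

/-! ### Linearity of the action -/

theorem slash_add (f g : RatFun I) (w : WeylGroup Γ) :
    slash Γ (f + g) w = slash Γ f w + slash Γ g w := map_add _ _ _

theorem slash_neg (f : RatFun I) (w : WeylGroup Γ) : slash Γ (-f) w = -slash Γ f w :=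
  map_neg _ _

/-- The action is linear over functions fixed by all `σ_i` and `ε_i`. This serves for polynomials in
`u`, for `x^(nδ)`, and for orbit sums of even exponents. -/
theorem slash_invariant_mul {h : RatFun I} (hr : ∀ i, refl Γ i h = h) (hs : ∀ i, sgn Γ i h = h)
    (f : RatFun I) (w : WeylGroup Γ) : slash Γ (h * f) w = h * slash Γ f w := by
  induction w using (coxSys Γ).simple_induction_right with
  | one => rw [slash_one, slash_one]
  | mul_simple_right w i ih =>
    rw [slash_mul, slash_mul, ih, CoxeterMatrix.toCoxeterSystem_simple, slash_simple, slash_simple]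
    simp only [map_mul, hr, hs]
    ring

theorem slash_ofPoly_mul (p : ℂ[X]) (f : RatFun I) (w : WeylGroup Γ) :
    slash Γ (ofPoly p * f) w = ofPoly p * slash Γ f w :=
  slash_invariant_mul Γ (fun i => refl_ofPoly Γ i p) (fun i => sgn_ofPoly Γ i p) f w

theorem slash_mono_sigma (i : I) (a : I → ℤ) : slash Γ (mono a) (sigma Γ i) =
    mono (reflect Γ i a) * (J (xvar i) 0 + ((nbrSum Γ i a).negOnePow : ℤ) * J (xvar i) 1) := by
  rw [slash_simple, sgn_mono, map_mul, map_intCast, refl_mono]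
  ring

theorem J_zero_sub_J_one (y : RatFun I) : J y 0 - J y 1 = -y := by
  have h2 := two_ne_zero' (I := I)
  rw [J, J, ← mul_sub]
  field_simp
  ring

theorem J_zero_add_J_one (y : RatFun I) : J y 0 + J y 1 = y * ((uvar - y) / (1 - uvar * y)) := by
  have h2 := two_ne_zero' (I := I)
  rw [J, J, ← mul_add]
  generalize (uvar - y) / (1 - uvar * y) = q
  field_simp
  ring

theorem slash_mono_sigma_of_odd (i : I) (a : I → ℤ) (h : Odd (nbrSum Γ i a)) :
    slash Γ (mono a) (sigma Γ i) = -mono (reflect Γ i a + Pi.single i 1) := by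
  rw [slash_mono_sigma, Int.negOnePow_odd _ h, mono_add, ← mul_neg, ← J_zero_sub_J_one]
  simp [sub_eq_add_neg]

/-- A single monomial would leave the denominator `1 - u x_i`. Both monomials have the same `v_i`,
and the reflection turns the difference into `x^(σ_i a) (1 - u x_i)`, which cancels it. -/
theorem slash_mono_sigma_of_even (i : I) (a : I → ℤ) (h : Even (nbrSum Γ i a)) :
    slash Γ (mono a - uvar * mono (a - Pi.single i 1)) (sigma Γ i) =
      uvar * mono (reflect Γ i a + Pi.single i 1) - mono (reflect Γ i a + Pi.single i 2) := by
  have hn : nbrSum Γ i (a - Pi.single i 1) = nbrSum Γ i a := by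
    rw [sub_eq_add_neg, nbrSum_add, ← Pi.single_neg, nbrSum_single]
    simp
  have hr : reflect Γ i (a - Pi.single i 1) = reflect Γ i a + Pi.single i 1 := by
    rw [← sub_neg_eq_add, ← reflect_single_self Γ i]
    exact map_sub (reflectEquiv Γ i) a _
  have h2 : (Pi.single i 2 : I → ℤ) = Pi.single i 1 + Pi.single i 1 := by
    rw [← Pi.single_add]
    rfl
  rw [sub_eq_add_neg, slash_add, slash_neg, slash_ofPoly_mul, slash_mono_sigma, slash_mono_sigma,
    hn, hr, Int.negOnePow_even _ h, Units.val_one, Int.cast_one, one_mul, J_zero_add_J_one, h2]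
  simp only [mono_add]
  have hd := div_mul_cancel₀ (uvar - xvar i) (one_sub_ne_zero (Pi.single i (1 : ℤ)))
  linear_combination (mono (reflect Γ i a) * xvar i) * hd

/-- The series `∑_w (f|w)(x; u)` converges absolutely, with sum `s`. -/
def HasAverage (x : I → ℂˣ) (u : ℂ) (f : RatFun I) (s : ℂ) : Prop :=
  ∃ z : WeylGroup Γ → ℂ, (∀ w, HasValueAt (slash Γ f w) x u (z w)) ∧ HasSum z s

variable {Γ} {x : I → ℂˣ} {u : ℂ} {f g : RatFun I} {s t : ℂ}

theorem HasAverage.add (hf : HasAverage Γ x u f s) (hg : HasAverage Γ x u g t) :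
    HasAverage Γ x u (f + g) (s + t) := by
  obtain ⟨z, hz, hs⟩ := hf
  obtain ⟨z', hz', hs'⟩ := hg
  exact ⟨_, fun w => by rw [slash_add]; exact (hz w).add (hz' w), hs.add hs'⟩

theorem HasAverage.neg (hf : HasAverage Γ x u f s) : HasAverage Γ x u (-f) (-s) := by
  obtain ⟨z, hz, hs⟩ := hf
  exact ⟨_, fun w => by rw [slash_neg]; exact (hz w).neg, hs.neg⟩

theorem HasAverage.sub (hf : HasAverage Γ x u f s) (hg : HasAverage Γ x u g t) :
    HasAverage Γ x u (f - g) (s - t) := by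
  rw [sub_eq_add_neg, sub_eq_add_neg]
  exact hf.add hg.neg

theorem HasAverage.invariant_mul {h : RatFun I} {c : ℂ} (hc : HasValueAt h x u c)
    (hr : ∀ i, refl Γ i h = h) (hs : ∀ i, sgn Γ i h = h) (hf : HasAverage Γ x u f s) :
    HasAverage Γ x u (h * f) (c * s) := by
  obtain ⟨z, hz, hsum⟩ := hf
  exact ⟨_, fun w => by rw [slash_invariant_mul Γ hr hs]; exact hc.mul (hz w), hsum.mul_left c⟩

theorem HasAverage.uvar_mul (hf : HasAverage Γ x u f s) :
    HasAverage Γ x u (uvar * f) (u * s) := by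
  refine hf.invariant_mul ?_ (fun i => refl_ofPoly Γ i _) fun i => sgn_ofPoly Γ i _
  simpa using hasValueAt_ofPoly x u Polynomial.X

/-- The values for `f|σ_i` are those for `f`, reindexed by `w ↦ σ_i w`. -/
theorem HasAverage.slash_sigma (hf : HasAverage Γ x u f s) (i : I) :
    HasAverage Γ x u (slash Γ f (sigma Γ i)) s := by
  obtain ⟨z, hz, hs⟩ := hf
  refine ⟨fun w => z (sigma Γ i * w), fun w => ?_, ?_⟩
  · rw [← slash_mul]
    exact hz _
  · exact (Equiv.mulLeft (sigma Γ i)).hasSum_iff.mpr hs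

theorem HasAverage.unique (hf : HasAverage Γ x u f s) (hf' : HasAverage Γ x u f t) : s = t := by
  obtain ⟨z, hz, hs⟩ := hf
  obtain ⟨z', hz', hs'⟩ := hf'
  rw [funext fun w => (hz' w).unique (hz w)] at hs'
  exact hs.unique hs'

end General

/-! ### The recursion for the averages in type `D₄⁽¹⁾` -/

theorem InRegion.hasAverage {x : Fin 5 → ℂˣ} {u : ℂ} (h : InRegion x u) (a : Fin 5 → ℤ) :
    HasAverage affineD4 x u (mono a) (average (mono a) x u) := by
  obtain ⟨hreg, hsum⟩ := isRegularAt_and_summable h a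
  refine ⟨_, fun w => ?_, hsum.hasSum⟩
  obtain ⟨z, hz⟩ := hreg w
  rwa [hz.value_eq]

variable {x : Fin 5 → ℂˣ} {u : ℂ}

theorem average_of_odd (h : InRegion x u) (i : Fin 5) (a : Fin 5 → ℤ)
    (hv : Odd (nbrSum affineD4 i a)) :
    average (mono a) x u = -average (mono (reflect affineD4 i a + Pi.single i 1)) x u := by
  have h1 := (h.hasAverage a).slash_sigma i
  rw [slash_mono_sigma_of_odd _ _ _ hv] at h1
  exact h1.unique (h.hasAverage _).neg

theorem average_of_even (h : InRegion x u) (i : Fin 5) (a : Fin 5 → ℤ)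
    (hv : Even (nbrSum affineD4 i a)) :
    average (mono a) x u - u * average (mono (a - Pi.single i 1)) x u =
      u * average (mono (reflect affineD4 i a + Pi.single i 1)) x u -
        average (mono (reflect affineD4 i a + Pi.single i 2)) x u := by
  have h1 := ((h.hasAverage a).sub (h.hasAverage (a - Pi.single i 1)).uvar_mul).slash_sigma i
  rw [slash_mono_sigma_of_even _ _ _ hv] at h1
  exact h1.unique ((h.hasAverage _).uvar_mul.sub (h.hasAverage _))

/-- The average relations hold at every vertex, without a descent condition. In the two boundary
cases the average of `x^a` itself reappears on the right with a minus sign, and one divides by `2`.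
-/
theorem average_recursionStep (h : InRegion x u) (i : Fin 5) (a : Fin 5 → ℤ) :
    average (mono a) x u = ((recursionStep i a).map fun t =>
      Polynomial.aeval u t.1 * average (mono t.2) x u).sum := by
  unfold recursionStep
  simp only [two_smul_single]
  split_ifs with h1 h2 h2
  · have h3 := average_of_odd h i a h1
    rw [reflect_add_single, h2] at h3
    simp at h3 ⊢
    linear_combination (1 / 2) * h3
  · rw [average_of_odd h i a h1]
    simp
  · rw [Int.not_odd_iff_even] at h1
    have h3 := average_of_even h i a h1
    rw [reflect_add_single, reflect_add_single, h2,
      show nbrSum affineD4 i a + 2 - nbrSum affineD4 i a - 1 = 1 by ring,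
      show nbrSum affineD4 i a + 2 - nbrSum affineD4 i a - 2 = 0 by ring, Pi.single_zero,
      sub_zero] at h3
    simp
    linear_combination (1 / 2) * h3
  · rw [Int.not_odd_iff_even] at h1
    have h3 := average_of_even h i a h1
    simp
    linear_combination h3

/-- Since `v_i(nδ) = 2 (nδ)_i` is even, `x^(nδ)` is fixed by every `σ_i` and `ε_i` and factors out
of the average. -/
theorem average_zsmul_delta (h : InRegion x u) (n : ℤ) :
    average (mono (n • delta)) x u = (monoVal x delta : ℂ) ^ n * average 1 x u := by
  have h0 := h.hasAverage 0
  rw [mono_zero] at h0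
  have h1 := (h0.invariant_mul (h := mono (n • delta)) (hasValueAt_mono x u _) (fun i => ?_)
    fun i => ?_)
  · rw [mul_one] at h1
    rw [(h.hasAverage _).unique h1, monoVal_zsmul, Units.val_zpow_eq_zpow_val]
  · rw [refl_mono, reflect, nbrSum_zsmul_delta, sub_self, Pi.single_zero, add_zero]
  · rw [sgn_mono, nbrSum_zsmul_delta, Int.negOnePow_two_mul]
    simp

/-- `evalCoeff` as a ring homomorphism. -/
def evalCoeffHom (y : ℂˣ) (u : ℂ) : (ℤ[X])[T;T⁻¹] →+* ℂ :=
  LaurentPolynomial.eval₂ (Polynomial.aeval u : ℤ[X] →ₐ[ℤ] ℂ).toRingHom y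

theorem evalCoeffHom_sum_map (y : ℂˣ) (u : ℂ) (C : (Fin 5 → ℤ) → (ℤ[X])[T;T⁻¹])
    (l : List (ℤ[X] × (Fin 5 → ℤ))) :
    evalCoeffHom y u (l.map fun t => LaurentPolynomial.C t.1 * C t.2).sum =
      (l.map fun t => Polynomial.aeval u t.1 * evalCoeffHom y u (C t.2)).sum := by
  rw [map_list_sum, List.map_map]
  congr 2
  ext t
  simp [evalCoeffHom]

/-- If the recursion holds at one vertex for each `a`, then `Z_{W,g} = C_g(x^δ) Z_W`. -/
theorem average_eq_evalCoeff {C : (Fin 5 → ℤ) → (ℤ[X])[T;T⁻¹]}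
    (hbase : ∀ n : ℤ, C (n • delta) = LaurentPolynomial.T n)
    (hstep : ∀ a, (¬ ∃ n : ℤ, a = n • delta) → ∃ i, nbrSum affineD4 i a < 2 * a i ∧
      C a = ((recursionStep i a).map fun t => LaurentPolynomial.C t.1 * C t.2).sum)
    (h : InRegion x u) (a : Fin 5 → ℤ) :
    average (mono a) x u = evalCoeffHom (monoVal x delta) u (C a) * average 1 x u := by
  induction a using wellFounded_monoLT.induction with
  | _ a ih =>
    by_cases ha : ∃ n : ℤ, a = n • delta
    · obtain ⟨n, rfl⟩ := ha
      rw [average_zsmul_delta h, hbase]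
      simp [evalCoeffHom]
    · obtain ⟨i, hi, hC⟩ := hstep a ha
      rw [average_recursionStep h i a, hC, evalCoeffHom_sum_map, ← List.sum_map_mul_right]
      congr 1
      refine List.map_congr_left fun t ht => ?_
      rw [ih t.2 (monoLT_of_mem_recursionStep hi ht)]
      ring

/-! ### Consistency and uniqueness of the recursion -/

theorem inRegion_const {y : ℂˣ} (hy : ‖(y : ℂ)‖ ≤ 1 / 2) (hu : ‖u‖ ≤ 1 / 2) :
    InRegion (fun _ => y) u := by
  refine ⟨?_, fun b hb => ?_⟩
  · rw [monoVal_const, show ∑ i, delta i = (6 : ℕ) by decide, zpow_natCast,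
      Units.val_pow_eq_pow_val, norm_pow]
    exact pow_lt_one₀ (norm_nonneg _) (by linarith) (by norm_num)
  · have := norm_mul_monoVal_const_lt affineD4 hy hu hb
    constructor <;> intro h <;> rw [h] at this <;> simp at this

theorem infinite_image_Ioo (n : ℕ) (hn : n ≠ 0) {r : ℝ} (hr : 0 < r) :
    ((fun t : ℝ => (t : ℂ) ^ n) '' Set.Ioo 0 r).Infinite := by
  refine (Set.Ioo_infinite hr).image fun s hs t ht h => ?_
  have h' : s ^ n = t ^ n := by exact_mod_cast h
  exact (pow_left_inj₀ hs.1.le ht.1.le hn).mp h'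

/-- Multiply by a power of `T` to reach a polynomial `Q`. For each small `u` it vanishes at
infinitely many `t^6`, so each coefficient in `ℤ[u]` vanishes at infinitely many `u`. The sixth
powers occur because `δ` has height `6`, so `x^δ = y^6` on the diagonal. -/
theorem eq_zero_of_evalCoeffHom {P : (ℤ[X])[T;T⁻¹]} {r : ℝ} (hr : 0 < r)
    (h : ∀ (y : ℂˣ) (u : ℂ), ‖(y : ℂ)‖ < r → ‖u‖ ≤ 1 / 2 → evalCoeffHom (y ^ 6) u P = 0) :
    P = 0 := by
  obtain ⟨n, Q, hQ⟩ := P.exists_T_pow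
  have hQ0 : ∀ u : ℂ, ‖u‖ ≤ 1 / 2 →
      Q.map (Polynomial.aeval u : ℤ[X] →ₐ[ℤ] ℂ).toRingHom = 0 := fun u hu => by
    refine Polynomial.eq_zero_of_infinite_isRoot _
      ((infinite_image_Ioo 6 (by norm_num) hr).mono ?_)
    rintro _ ⟨t, ht, rfl⟩
    have ht0 : (t : ℂ) ≠ 0 := by exact_mod_cast ht.1.ne'
    have h1 := h (Units.mk0 (t : ℂ) ht0) u (by
      rw [Units.val_mk0, Complex.norm_real, Real.norm_of_nonneg ht.1.le]; exact ht.2) hu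
    have h2 := congrArg (evalCoeffHom (Units.mk0 (t : ℂ) ht0 ^ 6) u) hQ
    rw [map_mul, h1, zero_mul] at h2
    simpa [evalCoeffHom, Polynomial.eval_map] using h2
  have hQ' : Q = 0 := by
    ext1 k
    have hk : (Q.coeff k).map (Int.castRingHom ℂ) = 0 := by
      refine Polynomial.eq_zero_of_infinite_isRoot _
        ((infinite_image_Ioo 1 one_ne_zero (r := 1 / 2) (by norm_num)).mono ?_)
      rintro _ ⟨t, ht, rfl⟩
      have h1 := congrArg (fun R => R.coeff k) (hQ0 t (by
        rw [Complex.norm_real, Real.norm_of_nonneg ht.1.le]; exact ht.2.le))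
      simpa [Polynomial.coeff_map, Polynomial.aeval_def, Polynomial.eval_map] using h1
    exact (Polynomial.map_eq_zero_iff Int.cast_injective).mp hk
  rw [hQ', map_zero] at hQ
  exact ((LaurentPolynomial.isUnit_T (n : ℤ)).mul_left_eq_zero).mp hQ.symm

theorem sum_map_attach {α β : Type*} [AddMonoid β] (l : List α) (g : α → β) :
    (l.attach.map fun t => g t.1).sum = (l.map g).sum := by
  rw [show (fun t : {t // t ∈ l} => g t.1) = g ∘ Subtype.val from rfl, ← List.map_map,
    List.attach_map_subtype_val]

/-- The solution of the recursion, computed with a chosen vertex at each step. -/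
theorem exists_chosen_recursion : ∃ C : (Fin 5 → ℤ) → (ℤ[X])[T;T⁻¹],
    (∀ n : ℤ, C (n • delta) = LaurentPolynomial.T n) ∧
    ∀ a, (¬ ∃ n : ℤ, a = n • delta) → ∃ i, nbrSum affineD4 i a < 2 * a i ∧
      C a = ((recursionStep i a).map fun t => LaurentPolynomial.C t.1 * C t.2).sum := by
  classical
  let F : (a : Fin 5 → ℤ) → ((b : Fin 5 → ℤ) → MonoLT b a → (ℤ[X])[T;T⁻¹]) → (ℤ[X])[T;T⁻¹] :=
    fun a rec =>
      if h : ∃ n : ℤ, a = n • delta then LaurentPolynomial.T h.choose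
      else ((recursionStep (exists_nbrSum_lt h).choose a).attach.map fun t =>
        LaurentPolynomial.C t.1.1 *
          rec t.1.2 (monoLT_of_mem_recursionStep (exists_nbrSum_lt h).choose_spec t.2)).sum
  refine ⟨wellFounded_monoLT.fix F, fun n => ?_, fun a ha => ?_⟩
  · rw [WellFounded.fix_eq]
    have h : ∃ m : ℤ, n • delta = m • delta := ⟨n, rfl⟩
    simp only [F]
    rw [dif_pos h]
    -- The chosen multiple of `δ` must be `n`, because the coordinate `0` of `δ` is `1`.
    have := congrFun h.choose_spec 0
    simp only [delta, Pi.smul_apply, Matrix.cons_val_zero, smul_eq_mul, mul_one] at this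
    exact congrArg LaurentPolynomial.T this.symm
  · refine ⟨_, (exists_nbrSum_lt ha).choose_spec, ?_⟩
    rw [WellFounded.fix_eq]
    simp only [F]
    rw [dif_neg ha]
    exact sum_map_attach _ fun t : ℤ[X] × (Fin 5 → ℤ) =>
      LaurentPolynomial.C t.1 * wellFounded_monoLT.fix F t.2

theorem satisfiesRecursion_unique {C C' : (Fin 5 → ℤ) → (ℤ[X])[T;T⁻¹]}
    (hC : SatisfiesRecursion C) (hC' : SatisfiesRecursion C') : C' = C := by
  ext1 a
  induction a using wellFounded_monoLT.induction with
  | _ a ih =>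
    by_cases ha : ∃ n : ℤ, a = n • delta
    · obtain ⟨n, rfl⟩ := ha
      rw [hC.1, hC'.1]
    · obtain ⟨i, hi⟩ := exists_nbrSum_lt ha
      rw [hC.2 a i hi, hC'.2 a i hi]
      congr 1
      refine List.map_congr_left fun t ht => ?_
      rw [ih t.2 (monoLT_of_mem_recursionStep hi ht)]

theorem exists_satisfiesRecursion : ∃ C : (Fin 5 → ℤ) → (ℤ[X])[T;T⁻¹], SatisfiesRecursion C ∧
    ∀ (a : Fin 5 → ℤ) (x : Fin 5 → ℂˣ) (u : ℂ), InRegion x u →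
      average (mono a) x u = evalCoeff (C a) (monoVal x delta) u * average 1 x u := by
  obtain ⟨C, hbase, hstep⟩ := exists_chosen_recursion
  have hC : ∀ (a : Fin 5 → ℤ) (x : Fin 5 → ℂˣ) (u : ℂ), InRegion x u → _ :=
    fun a x u h => average_eq_evalCoeff hbase hstep h a
  refine ⟨C, ⟨hbase, fun a i _ => ?_⟩, hC⟩
  rw [← sub_eq_zero]
  -- The radius comes from `5 · 4‖y‖ ≤ 1/3`, the condition under which `Z_W` does not vanish at the
  -- diagonal point.
  refine eq_zero_of_evalCoeffHom (r := 1 / 60) (by norm_num) fun y u hy hu => ?_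
  have hy2 : ‖(y : ℂ)‖ ≤ 1 / 2 := by linarith
  have h := inRegion_const hy2 hu
  have hne : average 1 (fun _ => y) u ≠ 0 :=
    tsum_value_const_ne_zero affineD4 hy2 (by simp only [Fintype.card_fin]; push_cast; linarith) hu
  have hδ : monoVal (fun _ => y) delta = y ^ 6 := by
    rw [monoVal_const, show ∑ i, delta i = (6 : ℕ) by decide, zpow_natCast]
  have h1 := average_recursionStep h i a
  rw [hC a _ u h, List.map_congr_left fun t _ => by rw [hC t.2 _ u h, ← mul_assoc],
    List.sum_map_mul_right, hδ] at h1
  rw [map_sub, evalCoeffHom_sum_map, mul_right_cancel₀ hne h1, sub_self]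

section General

variable {I : Type*} [Fintype I] [DecidableEq I] (Γ : SimpleGraph I) [DecidableRel Γ.Adj]

/-! ### Finite Weyl groups -/

theorem slash_sum {ι : Type*} (s : Finset ι) (f : ι → RatFun I) (w : WeylGroup Γ) :
    slash Γ (∑ k ∈ s, f k) w = ∑ k ∈ s, slash Γ (f k) w := map_sum _ _ _

theorem hasValueAt_sum {ι : Type*} (s : Finset ι) {f : ι → RatFun I} {z : ι → ℂ} {x : I → ℂˣ}
    {u : ℂ} (h : ∀ k, HasValueAt (f k) x u (z k)) :
    HasValueAt (∑ k ∈ s, f k) x u (∑ k ∈ s, z k) := by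
  classical
  induction s using Finset.induction_on with
  | empty => exact hasValueAt_zero x u
  | insert k s hk ih =>
    rw [Finset.sum_insert hk, Finset.sum_insert hk]
    exact (h k).add ih

theorem ofPoly_mul (p q : ℂ[X]) : (ofPoly (p * q) : RatFun I) = ofPoly p * ofPoly q := by
  rw [ofPoly, ofPoly, ofPoly, ← map_mul, AddMonoidAlgebra.single_mul_single, zero_add]

theorem ofPoly_add (p q : ℂ[X]) : (ofPoly (p + q) : RatFun I) = ofPoly p + ofPoly q := by
  rw [ofPoly, ofPoly, ofPoly, ← map_add, AddMonoidAlgebra.single_add]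

variable [Fintype (WeylGroup Γ)]

/-- Specialise to a small diagonal point with `u = 0`, where the value of the sum is known to be
nonzero. -/
theorem sum_slash_one_ne_zero : ∑ w : WeylGroup Γ, slash Γ (1 : RatFun I) w ≠ 0 := by
  -- Chosen so that `|I| · 4r ≤ 1/3`; the `+ 1` keeps the denominator nonzero without any assumption
  -- on `I`.
  set r : ℝ := 1 / (12 * (Fintype.card I + 1))
  have hr : 0 < r := by positivity
  have hr12 : r ≤ 1 / 12 := by
    refine one_div_le_one_div_of_le (by norm_num) ?_
    have : (0 : ℝ) ≤ Fintype.card I := by positivity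
    linarith
  have hr3 : Fintype.card I * (4 * r) ≤ 1 / 3 := by
    simp only [r]
    rw [mul_one_div, mul_div_assoc', div_le_div_iff₀ (by positivity) (by norm_num)]
    linarith
  have hr0 : (r : ℂ) ≠ 0 := by exact_mod_cast hr.ne'
  have hn : ‖((Units.mk0 (r : ℂ) hr0 : ℂˣ) : ℂ)‖ = r := by
    rw [Units.val_mk0, Complex.norm_real, Real.norm_of_nonneg hr.le]
  have hy2 : ‖((Units.mk0 (r : ℂ) hr0 : ℂˣ) : ℂ)‖ ≤ 1 / 2 := by
    rw [hn]
    linarith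
  have hu : ‖(0 : ℂ)‖ ≤ 1 / 2 := by norm_num
  intro h
  refine tsum_value_const_ne_zero Γ hy2 (by rwa [hn]) hu ?_
  choose z hz _ using exists_hasValueAt_const Γ hy2 hu
  have h1 := hasValueAt_sum Finset.univ hz
  rw [h] at h1
  rw [tsum_fintype, Finset.sum_congr rfl fun w _ => (hz w).value_eq]
  exact h1.unique (hasValueAt_zero _ _)

/-- The sum of `x^(2 w α_i)` over `w ∈ W`. -/
def orbitSum (i : I) : RatFun I :=
  ∑ w : WeylGroup Γ, mono (2 • latticeHom Γ w (Pi.single i 1))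

theorem refl_orbitSum (i j : I) : refl Γ j (orbitSum Γ i) = orbitSum Γ i := by
  rw [orbitSum, map_sum]
  refine Fintype.sum_equiv (Equiv.mulLeft (sigma Γ j)) _ _ fun w => ?_
  rw [refl_mono, Equiv.coe_mulLeft, latticeHom_mul, latticeHom_sigma]
  exact congrArg mono (map_nsmul (reflectEquiv Γ j) 2 _)

/-- This is what the doubled exponents are for: every `v_j(2wα_i)` is even, so `ε_j` acts trivially.
-/
theorem sgn_orbitSum (i j : I) : sgn Γ j (orbitSum Γ i) = orbitSum Γ i := by
  rw [orbitSum, map_sum]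
  refine Finset.sum_congr rfl fun w _ => ?_
  rw [sgn_mono, two_nsmul, nbrSum_add, ← two_mul, Int.negOnePow_two_mul]
  simp

theorem ofPoly_mul_orbitSum_ne (i : I) (p q : ℂ[X]) (hq : q ≠ 0) :
    ofPoly q * orbitSum Γ i ≠ ofPoly p := by
  intro h
  have h1 : ∑ w : WeylGroup Γ,
      (AddMonoidAlgebra.single (2 • latticeHom Γ w (Pi.single i 1)) q : Laurent I) =
      AddMonoidAlgebra.single 0 p := by
    apply IsFractionRing.injective (Laurent I) (RatFun I)
    rw [map_sum]
    refine Eq.trans ?_ h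
    rw [orbitSum, Finset.mul_sum]
    refine Finset.sum_congr rfl fun w _ => ?_
    rw [ofPoly, mono, ← map_mul, AddMonoidAlgebra.single_mul_single, zero_add, mul_one]
  -- On the left this coefficient is `q` times the number of `w` with `2wα_i = 2α_i`, which is
  -- positive because `w = 1` counts; on the right it is `0`.
  have h2 := congrArg (fun f : Laurent I => f.coeff (2 • Pi.single i 1)) h1
  have h0 : (0 : I → ℤ) ≠ 2 • Pi.single i 1 := fun e => by
    simpa using congrFun e i
  simp only [AddMonoidAlgebra.coeff_sum, AddMonoidAlgebra.coeff_single, Finsupp.single_apply,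
    Finsupp.finsetSum_apply, if_neg h0] at h2
  rw [← Finset.sum_filter, Finset.sum_const, smul_eq_zero] at h2
  refine h2.elim (fun h3 => ?_) hq
  rw [Finset.card_eq_zero] at h3
  have : (1 : WeylGroup Γ) ∈ (∅ : Finset (WeylGroup Γ)) := by
    rw [← h3, Finset.mem_filter, latticeHom_one]
    exact ⟨Finset.mem_univ _, rfl⟩
  simp at this

theorem exists_average_ne_mul [Nonempty I] : ∃ a : I → ℤ, ∀ p q : ℂ[X], q ≠ 0 →
    ofPoly q * ∑ w : WeylGroup Γ, slash Γ (mono a) w ≠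
      ofPoly p * ∑ w : WeylGroup Γ, slash Γ 1 w := by
  classical
  by_contra! H
  obtain ⟨i⟩ := ‹Nonempty I›
  have key : ∀ s : Finset (WeylGroup Γ), ∃ p q : ℂ[X], q ≠ 0 ∧
      ofPoly q * ∑ v ∈ s, ∑ w : WeylGroup Γ,
        slash Γ (mono (2 • latticeHom Γ v (Pi.single i 1))) w =
      ofPoly p * ∑ w : WeylGroup Γ, slash Γ 1 w := by
    intro s
    induction s using Finset.induction_on with
    | empty => exact ⟨0, 1, one_ne_zero, by simp [ofPoly]⟩
    | insert v s hv ih =>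
      obtain ⟨p, q, hq, h⟩ := ih
      obtain ⟨p', q', hq', h'⟩ := H (2 • latticeHom Γ v (Pi.single i 1))
      refine ⟨p' * q + p * q', q * q', mul_ne_zero hq hq', ?_⟩
      rw [Finset.sum_insert hv, ofPoly_mul, ofPoly_add, ofPoly_mul, ofPoly_mul]
      linear_combination ofPoly q * h' + ofPoly q' * h
  obtain ⟨p, q, hq, h⟩ := key Finset.univ
  -- Summing the assumed proportionalities over the orbit gives `q h Z_W = p Z_W` for the invariant
  -- orbit sum `h`; cancelling `Z_W` would put `h` in `ℂ(u)`.
  refine ofPoly_mul_orbitSum_ne Γ i p q hq (mul_right_cancel₀ (sum_slash_one_ne_zero Γ) ?_)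
  rw [← h, Finset.sum_comm, mul_assoc, Finset.mul_sum _ _ (orbitSum Γ i)]
  congr 1
  refine Finset.sum_congr rfl fun w _ => ?_
  rw [← slash_invariant_mul Γ (refl_orbitSum Γ i) (sgn_orbitSum Γ i), mul_one, orbitSum, slash_sum]

end General

end ChintaGunnells

end

open ChintaGunnells in
theorem propositionp3p3 :
    -- the order on monomials is a well-founded one, whose minimal elements are the `x^(nδ)`,
    -- and each step of the recursion leads to strictly smaller monomials
    WellFounded MonoLT ∧
    (∀ a : Fin 5 → ℤ, (¬ ∃ n : ℤ, a = n • delta) → ∃ i, nbrSum affineD4 i a < 2 * a i) ∧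
    (∀ (a : Fin 5 → ℤ) (i : Fin 5), nbrSum affineD4 i a < 2 * a i →
      ∀ t ∈ recursionStep i a, MonoLT t.2 a) ∧
    -- the recursion has exactly one solution `C`, and `Z_{W,g} = C_g(x^δ) Z_W`
    (∃ C : (Fin 5 → ℤ) → LaurentPolynomial (Polynomial ℤ),
      SatisfiesRecursion C ∧ (∀ C', SatisfiesRecursion C' → C' = C) ∧
      ∀ (a : Fin 5 → ℤ) (x : Fin 5 → ℂˣ) (u : ℂ), InRegion x u →
        (∀ w : WeylGroup affineD4, IsRegularAt (slash affineD4 (mono a) w) x u) ∧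
        (Summable fun w : WeylGroup affineD4 => value (slash affineD4 (mono a) w) x u) ∧
        average (mono a) x u = evalCoeff (C a) (monoVal x delta) u * average 1 x u) ∧
    -- for a finite Weyl group, some `Z_{W,g}` is not a multiple of `Z_W` by an element of `ℂ(u)`
    (∀ (I : Type) [Fintype I] [DecidableEq I] [Nonempty I] (Γ : SimpleGraph I)
      [DecidableRel Γ.Adj] [Fintype (WeylGroup Γ)],
      ∃ a : I → ℤ, ∀ p q : Polynomial ℂ, q ≠ 0 →
        ofPoly q * ∑ w : WeylGroup Γ, slash Γ (mono a) w ≠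
          ofPoly p * ∑ w : WeylGroup Γ, slash Γ 1 w) := by
  obtain ⟨C, hC, havg⟩ := exists_satisfiesRecursion
  refine ⟨wellFounded_monoLT, fun a h => exists_nbrSum_lt h,
    fun a i h t ht => monoLT_of_mem_recursionStep h ht,
    ⟨C, hC, fun C' hC' => satisfiesRecursion_unique hC hC', fun a x u h =>
      ⟨(isRegularAt_and_summable h a).1, (isRegularAt_and_summable h a).2, havg a x u h⟩⟩, ?_⟩
  intro I _ _ _ Γ _ _
  exact exists_average_ne_mul Γ
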